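/- Let $L\ge 1$, let $d_0,\dots,d_L$ be dimensions, $m$ an output dimension, $s_l>d_l/2$ for $0\le l\le L$, and let $M\in\mathbb R^{m\times m}$ be symmetric positive semi-definite. For a finite-dimensional Euclidean space $E$ and $s>\dim E/2$ let $H^s(E,\mathbb R^m)$ be the reproducing kernel Hilbert space of (continuous) functions $E\to\mathbb R^m$ with kernel $K_s=k_sM$, where $k_s(x,y)=(2\pi)^{-\dim E}\int_E(1+\|\omega\|^2)^{-s}\cos\langle x-y,\omega\rangle\,d\omega$ is the Sobolev kernel. Equivalently, with $\hat h(\omega)=(2\pi)^{-\dim E/2}\int_E h(x)e^{i\langle x,\omega\rangle}dx$, $$\|f\|_{H^s(E,\mathbb R^m)}=\inf\Big\{\Big(\int_E(1+\|\omega\|^2)^s\|\hat h(\omega)\|^2d\omega\Big)^{1/2} : f=M^{1/2}h\Big\}$$ (for $M=I$ this is the usual Sobolev norm of $f$). For a map $\varphi$ let $\mathcal K_\varphi h=h\circ\varphi$. Fix $g\in H^{s_L}(\mathbb R^{d_L},\mathbb R^m)$ and maps $\sigma_l:\mathbb R^{d_l}\to\mathbb R^{d_l}$ ($1\le l\le L-1$)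 for which $\mathcal K_{\sigma_l}$ is a bounded operator on $H^{s_l}(\mathbb R^{d_l},\mathbb R^m)$, with operator norm $\|\mathcal K_{\sigma_l}\|$. Fix $C,D>0$ and let, for $1\le l\le L$, $$\mathcal W_l^{C,D}=\{W\in\mathbb R^{d_l\times d_{l-1}} : d_l\ge d_{l-1},\ \|W\|\le C,\ \det(W^\top W)^{1/2}\ge D\},$$ where $\|W\|$ is the spectral norm. Let $A_l\subseteq\mathbb R^{d_l}$ be arbitrary sets of allowed biases (for instance a single fixed bias, or all of $\mathbb R^{d_l}$), and write $b_l(x)=x+a_l$ with $a_l\in A_l$. Assume that $\mathcal K_W$ maps $H^{s_l}(\mathbb R^{d_l},\mathbb R^m)$ into $H^{s_{l-1}}(\mathbb R^{d_{l-1}},\mathbb R^m)$ for every $W\in\mathcal W_l^{C,D}$, $1\le l\le L$. Let $\mathcal F_{\rm inj}$ be the class of all networks $$f=g\circ b_L\circ W_L\circ\sigma_{L-1}\circ b_{L-1}\circ W_{L-1}\circ\cdots\circ\sigma_1\circ b_1\circ W_1,\qquad W_l\in\mathcal W_l^{C,D},\ a_l\in A_l,$$ and put $f_l=g\circ b_L\circ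 W_L\circ\sigma_{L-1}\circ\cdots\circ\sigma_l\circ b_l$ (so $f_L=g\circ b_L$) and $$G_l=\frac{\|f_l|_{\mathcal R(W_l)}\|_{H^{s_{l-1}}(\mathcal R(W_l),\mathbb R^m)}}{\|f_l\|_{H^{s_l}(\mathbb R^{d_l},\mathbb R^m)}}\qquad(0/0:=0),$$ where $\mathcal R(W_l)$ is the range of $W_l$. Let $x_1,\dots,x_n\in X\subseteq\mathbb R^{d_0}$ and $k_{s_0}(x,x')\le\kappa$ for all $x,x'\in X$. Then the empirical Rademacher complexity $$\hat{\mathfrak R}_n(\mathcal F_{\rm inj})=\mathbb E_{\sigma}\Big[\sup_{f\in\mathcal F_{\rm inj}}\frac1n\Big|\sum_{i=1}^n\langle\boldsymbol\sigma_i,f(x_i)\rangle\Big|\Big],$$ with $\boldsymbol\sigma_1,\dots,\boldsymbol\sigma_n$ independent and uniform on $\{-1,1\}^m$, satisfies $$\hat{\mathfrak R}_n(\mathcal F_{\rm inj})\le\|g\|_{H^{s_L}(\mathbb R^{d_L},\mathbb R^m)}\sqrt{\frac{\kappa}{n}\operatorname{Tr}(M)}\;\sup_{W_l\in\mathcal W_l^{C,D},\,a_l\in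 A_l}\ \prod_{l=1}^L\left(G_l\,\sup_{\omega\in\mathcal R(W_l)}\left|\frac{1+\|W_l^\top\omega\|_2^2}{1+\|\omega\|_2^2}\right|^{s_{l-1}/2}\frac1{\det(W_l^\top W_l)^{1/4}}\right)\ \prod_{l=1}^{L-1}\|\mathcal K_{\sigma_l}\| .$$ Both sides are understood in $[0,\infty]$. -/

import Mathlib

open MeasureTheory FourierTransform
open scoped ENNReal NNReal Matrix MatrixOrder

noncomputable section

/-- `Vec k` is Euclidean space `ℝᵏ`. -/
abbrev Vec (k : ℕ) : Type := EuclideanSpace ℝ (Fin k)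

/-! ### Sobolev norms

The domain `E` is an arbitrary finite-dimensional real inner product space with its Lebesgue
measure, so that the same definition serves for `ℝᵈ` and for the range of a weight matrix. -/

section Sobolev

variable {E : Type*} [NormedAddCommGroup E] [InnerProductSpace ℝ E] [FiniteDimensional ℝ E]
  [MeasurableSpace E] [BorelSpace E]

/-- The inclusion `ℝᵐ ⊆ ℂᵐ`. -/
def complexify {m : ℕ} (v : Vec m) : EuclideanSpace ℂ (Fin m) :=
  WithLp.toLp 2 fun j => ((v j : ℝ) : ℂ)

/-- The unitary Fourier transform on `L²`: the extension of
`f̂(ω) = (2π)^{-d/2} ∫ f(x) e^{i ⟨x, ω⟩} dx`, `d = dim E`.  The operator `𝓕` of Mathlib extends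
`ξ ↦ ∫ f(x) e^{-2πi ⟨x, ξ⟩} dx`, so it is evaluated at `ξ = -ω / (2π)`. -/
def unitaryFourier {m : ℕ} (F : Lp (EuclideanSpace ℂ (Fin m)) 2 (volume : Measure E)) :
    E → EuclideanSpace ℂ (Fin m) := fun ω =>
  ((2 * Real.pi) ^ (-(Module.finrank ℝ E : ℝ) / 2) : ℝ) •
    (𝓕 F : Lp (EuclideanSpace ℂ (Fin m)) 2 (volume : Measure E)) (-(2 * Real.pi)⁻¹ • ω)

open Classical in
/-- The norm `(∫ (1 + ‖ω‖²)ˢ ‖f̂(ω)‖² dω)^{1/2}` of the Sobolev space `Hˢ(E, ℝᵐ)`, with value `∞`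
if `f` is not in the space.  It is used for `s > dim E / 2`, where the elements of `Hˢ` are
continuous functions. -/
def sobolevNorm {m : ℕ} (s : ℝ) (f : E → Vec m) : ℝ≥0∞ :=
  if h : Continuous f ∧ MemLp (fun x => complexify (f x)) 2 (volume : Measure E) then
    (∫⁻ ω : E, ENNReal.ofReal ((1 + ‖ω‖ ^ 2) ^ s) *
      ‖unitaryFourier h.2.toLp ω‖ₑ ^ 2) ^ (1 / 2 : ℝ)
  else ∞

/-- The norm of the vector-valued reproducing kernel Hilbert space `Hˢ(E, ℝᵐ)` with kernel
`k_s M`: this space is `M^{1/2} Hˢ` with the quotient norm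
`‖f‖ = inf {‖h‖ : f = M^{1/2} h}` (and `∞` if `f` is not in the space).  For invertible `M` it is
`(∫ (1 + ‖ω‖²)ˢ f̂(ω)^* M⁻¹ f̂(ω) dω)^{1/2}`, and for `M = 1` it is `sobolevNorm`. -/
def vvNorm {m : ℕ} (M : Matrix (Fin m) (Fin m) ℝ) (s : ℝ) (f : E → Vec m) : ℝ≥0∞ :=
  ⨅ (h : E → Vec m) (_ : ∀ x, f x = Matrix.toEuclideanLin (CFC.sqrt M) (h x)), sobolevNorm s h

/-- The scalar reproducing kernel of the Sobolev space of order `s`,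
`k_s(x, y) = (2π)^{-d} ∫ (1 + ‖ω‖²)^{-s} cos ⟨x - y, ω⟩ dω`. -/
def sobolevKernel (s : ℝ) (x y : E) : ℝ :=
  (2 * Real.pi) ^ (-(Module.finrank ℝ E : ℝ)) *
    ∫ ω : E, (1 + ‖ω‖ ^ 2) ^ (-s) * Real.cos (inner ℝ (x - y) ω)

/-- The operator norm of the composition (Koopman) operator `h ↦ h ∘ φ` on the vector-valued
space of order `s`; it is finite if and only if the operator is defined on the whole space and
bounded. -/
def koopmanNorm {m : ℕ} (M : Matrix (Fin m) (Fin m) ℝ) (s : ℝ) (φ : E → E) : ℝ≥0∞ :=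
  sInf {c | ∀ h : E → Vec m, vvNorm M s h < ∞ → vvNorm M s (h ∘ φ) ≤ c * vvNorm M s h}

end Sobolev

/-! ### Empirical Rademacher complexity -/

/-- `E_σ sup_{f ∈ H} (1/n) |∑ᵢ ⟨σᵢ, f(xᵢ)⟩|`, with `σ` uniform on `{-1, 1}^{n × m}`. -/
def empiricalRademacher {X : Type*} {n m : ℕ} (H : Set (X → Vec m)) (x : Fin n → X) : ℝ≥0∞ :=
  (Fintype.card (Fin n → Fin m → ℤˣ) : ℝ≥0∞)⁻¹ *
    ∑ ε : Fin n → Fin m → ℤˣ, ⨆ f ∈ H,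
      ENNReal.ofReal (1 / n * |∑ i, ∑ j, ((ε i j : ℤ) : ℝ) * f (x i) j|)

/-! ### Networks

`L` is the number of layers and `d l` (`0 ≤ l ≤ L`) are the widths.  The weight matrix of layer
`l + 1` is `W l`, its bias is `a (l + 1)`, and `σ l` (`1 ≤ l ≤ L - 1`) is the activation of layer
`l`.  Entries of these families outside the indicated ranges play no role. -/

section Network

variable {m L : ℕ} {d : ℕ → ℕ}

/-- The linear map `ℝᵏ → ℝᵏ'` of a `k' × k` matrix. -/
abbrev linMap {k k' : ℕ} (W : Matrix (Fin k') (Fin k) ℝ) : Vec k →ₗ[ℝ] Vec k' :=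
  Matrix.toEuclideanLin W

/-- The weight matrices `W` with `k' ≥ k`, `‖W‖ ≤ C` and `det(Wᵀ W)^{1/2} ≥ D`. -/
def weightSet (C D : ℝ) (k k' : ℕ) : Set (Matrix (Fin k') (Fin k) ℝ) :=
  {W | k ≤ k' ∧ ‖(linMap W).toContinuousLinearMap‖ ≤ C ∧ D ≤ (Wᵀ * W).det ^ (1 / 2 : ℝ)}

/-- The part of the network that follows the shift of layer `l`:
`g ∘ b_L ∘ W_L ∘ σ_{L-1} ∘ ⋯ ∘ W_{l+1} ∘ σ_l`, which is `g` for `l = L`. -/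
def afterShift (g : Vec (d L) → Vec m) (σ : ∀ l, Vec (d l) → Vec (d l))
    (W : ∀ l, Matrix (Fin (d (l + 1))) (Fin (d l)) ℝ) (a : ∀ l, Vec (d l))
    {l : ℕ} (hl : l ≤ L) : Vec (d l) → Vec m :=
  Nat.decreasingInduction (motive := fun k _ => Vec (d k) → Vec m)
    (fun k _ next x => next (linMap (W k) (σ k x) + a (k + 1))) g hl

/-- `f_l = g ∘ b_L ∘ W_L ∘ σ_{L-1} ∘ ⋯ ∘ W_{l+1} ∘ σ_l ∘ b_l`. -/
def tailNet (g : Vec (d L) → Vec m) (σ : ∀ l, Vec (d l) → Vec (d l))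
    (W : ∀ l, Matrix (Fin (d (l + 1))) (Fin (d l)) ℝ) (a : ∀ l, Vec (d l))
    {l : ℕ} (hl : l ≤ L) : Vec (d l) → Vec m :=
  fun x => afterShift g σ W a hl (x + a l)

/-- The network `f = f_1 ∘ W_1`. -/
def network (hL : 1 ≤ L) (g : Vec (d L) → Vec m) (σ : ∀ l, Vec (d l) → Vec (d l))
    (W : ∀ l, Matrix (Fin (d (l + 1))) (Fin (d l)) ℝ) (a : ∀ l, Vec (d l)) :
    Vec (d 0) → Vec m :=
  fun x => tailNet g σ W a hL (linMap (W 0) x)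

/-- The pairs (weights, biases) with all weight matrices in `weightSet C D` and with the bias of
layer `l` in the prescribed set `A l`. -/
def admissible (L : ℕ) (d : ℕ → ℕ) (C D : ℝ) (A : ∀ l, Set (Vec (d l))) :
    Set ((∀ l, Matrix (Fin (d (l + 1))) (Fin (d l)) ℝ) × (∀ l, Vec (d l))) :=
  {p | ∀ l < L, p.1 l ∈ weightSet C D (d l) (d (l + 1)) ∧ p.2 (l + 1) ∈ A (l + 1)}

/-- The class of all networks with admissible weights and biases. -/
def injClass (hL : 1 ≤ L) (g : Vec (d L) → Vec m) (σ : ∀ l, Vec (d l) → Vec (d l))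
    (C D : ℝ) (A : ∀ l, Set (Vec (d l))) : Set (Vec (d 0) → Vec m) :=
  {f | ∃ p ∈ admissible L d C D A, f = network hL g σ p.1 p.2}

/-- `‖h|_{R(W)}‖ / ‖h‖`, the norms being those of order `s` on the subspace `R(W)` and of
order `s'` on the whole space. -/
def normRatio {k k' : ℕ} (M : Matrix (Fin m) (Fin m) ℝ) (s s' : ℝ)
    (W : Matrix (Fin k') (Fin k) ℝ) (h : Vec k' → Vec m) : ℝ≥0∞ :=
  vvNorm M s (fun y : LinearMap.range (linMap W) => h y) / vvNorm M s' h

/-- `sup_{ω ∈ R(W)} |(1 + ‖Wᵀ ω‖²) / (1 + ‖ω‖²)|^{s/2} · det(Wᵀ W)^{-1/4}`. -/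
def weightFactor {k k' : ℕ} (s : ℝ) (W : Matrix (Fin k') (Fin k) ℝ) : ℝ≥0∞ :=
  (⨆ ω ∈ LinearMap.range (linMap W),
      ENNReal.ofReal (|(1 + ‖linMap Wᵀ ω‖ ^ 2) / (1 + ‖ω‖ ^ 2)| ^ (s / 2))) *
    ENNReal.ofReal (1 / (Wᵀ * W).det ^ (1 / 4 : ℝ))

end Network

end

/-! A network is `g` after a chain of composition operators, so its norm in the space of order `s 0`
is at most ‖g‖ times one factor per operator. A shift multiplies the Fourier transform by a
unimodular function and costs nothing; an activation costs its Koopman norm by definition.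
Composition with W splits as restriction to R(W), whose cost is the ratio G_l, followed by
composition with the isomorphism of ℝᵏ onto R(W). On the Fourier side the latter is the substitution
η = Wᵀξ with Jacobian J = det(WᵀW)^{1/2}: the spectrum acquires J⁻¹, the measure J, and the weight
changes by at most the supremum over R(W), so the norm gains that supremum times J^{-1/2}
(`sobolevNorm_comp_linear_le`, `exists_transposeEquiv`, `vvNorm_network_le`).

It remains to bound the complexity of a norm ball. For s > dim/2 the spectrum is integrable
(`exists_hasSpectrum`), so point values are Fourier integrals, and Cauchy–Schwarz in the weighted L²
space gives the reproducing inequality (`sum_inner_le_vvNorm`). Averaged over signs, the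
off-diagonal kernel terms vanish, and Jensen leaves (1/n)·√(nκ Tr M)
(`empiricalRademacher_le_of_vvNorm_le`). -/

noncomputable section

/-! ### Agreement of the L² inverse Fourier transform with the integral on L¹ ∩ L². -/

section FourierLp

open scoped SchwartzMap ContDiff

variable {E F : Type*} [NormedAddCommGroup E] [InnerProductSpace ℝ E] [FiniteDimensional ℝ E]
  [MeasurableSpace E] [BorelSpace E]
  [NormedAddCommGroup F] [InnerProductSpace ℂ F] [CompleteSpace F]

/-- The inverse Fourier integral of an integrable function is continuous. -/
theorem continuous_fourierInv_of_integrable {F : Type*} [NormedAddCommGroup F] [NormedSpace ℂ F]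
    {u : E → F} (hu : Integrable u) : Continuous (𝓕⁻ u) := by
  rw [show (𝓕⁻ u : E → F) = fun w => 𝓕 u (-w) from
    funext (fun w => Real.fourierInv_eq_fourier_neg u w)]
  exact (VectorFourier.fourierIntegral_continuous Real.continuous_fourierChar
    (by exact continuous_inner) hu).comp continuous_neg

/-- Multiplication formula for the inverse Fourier integral. -/
theorem integral_fourierInv_smul_eq_of_integrable {φ : E → ℂ} {u : E → F}
    (hφ : Integrable φ) (hu : Integrable u) :
    ∫ ξ, 𝓕⁻ φ ξ • u ξ = ∫ x, φ x • 𝓕⁻ u x := by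
  -- Negating the bilinear form turns the forward multiplication formula into the inverse one.
  have h := VectorFourier.integral_fourierIntegral_smul_eq_flip (L := -innerₗ E)
    Real.continuous_fourierChar
    (by exact (continuous_inner (𝕜 := ℝ) (E := E)).neg) hφ hu
  have h1 : ∀ ξ : E, VectorFourier.fourierIntegral Real.fourierChar volume (-innerₗ E) φ ξ = 𝓕⁻ φ ξ := by
    intro ξ
    simp [VectorFourier.fourierIntegral, Real.fourierInv_eq]
  have h2 : ∀ ξ : E,
      VectorFourier.fourierIntegral Real.fourierChar volume (-innerₗ E).flip u ξ = 𝓕⁻ u ξ := by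
    intro ξ
    simp [VectorFourier.fourierIntegral, Real.fourierInv_eq, real_inner_comm]
  simpa only [h1, h2] using h

/-- On `L¹ ∩ L²` the inverse Fourier transform of `L²` is the inverse Fourier integral. -/
theorem Lp_fourierInv_toLp_ae_eq {u : E → F} (h1 : Integrable u) (h2 : MemLp u 2) :
    ((𝓕⁻ h2.toLp : Lp F 2 (volume : Measure E)) : E → F) =ᵐ[volume] 𝓕⁻ u := by
  -- Both sides are tested against smooth compactly supported functions. As a tempered distribution
  -- the L² transform is defined by moving 𝓕⁻ to the test function, and the multiplication formula
  -- moves it back onto u.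
  refine ae_eq_of_integral_contDiff_smul_eq ((Lp.memLp _).locallyIntegrable (by norm_num))
    (continuous_fourierInv_of_integrable h1).locallyIntegrable ?_
  intro g hg hgc
  have hc : HasCompactSupport (Complex.ofRealCLM ∘ g) := hgc.comp_left rfl
  have hd : ContDiff ℝ ∞ (Complex.ofRealCLM ∘ g) := by fun_prop
  set ψ : 𝓢(E, ℂ) := hc.toSchwartzMap hd
  have hψ : ∀ x, ψ x = (g x : ℂ) := fun x => rfl
  have e1 := congrArg (fun T => T ψ) (Lp.fourierInv_toTemperedDistribution_eq (h2.toLp))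
  simp only [TemperedDistribution.fourierInv_apply, Lp.toTemperedDistribution_apply] at e1
  have e2 : ∫ x, g x • ((𝓕⁻ h2.toLp : Lp F 2 (volume : Measure E)) : E → F) x
      = ∫ x, ψ x • ((𝓕⁻ h2.toLp : Lp F 2 (volume : Measure E)) : E → F) x := by
    simp [hψ]
  have e3 : ∫ x, g x • 𝓕⁻ u x = ∫ x, ψ x • 𝓕⁻ u x := by simp [hψ]
  rw [e2, e3, ← e1, ← integral_fourierInv_smul_eq_of_integrable ψ.integrable h1]
  refine integral_congr_ae ?_
  filter_upwards [h2.coeFn_toLp] with ξ hξ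
  rw [hξ, SchwartzMap.fourierInv_coe]

end FourierLp

/-! ### Sobolev functions as inverse Fourier integrals. -/

section Spectrum

variable {E : Type*} [NormedAddCommGroup E] [InnerProductSpace ℝ E] [FiniteDimensional ℝ E]
  [MeasurableSpace E] [BorelSpace E] {m : ℕ}

/-- `h` is the inverse Fourier integral of `u ∈ L¹ ∩ L²`. -/
structure HasSpectrum (h : E → Vec m) (u : E → EuclideanSpace ℂ (Fin m)) : Prop where
  integrable : Integrable u
  memLp : MemLp u 2
  eq_fourierInv : ∀ x, complexify (h x) = 𝓕⁻ u x

/-- The weighted `L²` norm of a spectrum, in the normalisation of `𝓕`. -/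
def weightedSpectralNorm (s : ℝ) (u : E → EuclideanSpace ℂ (Fin m)) : ℝ≥0∞ :=
  (∫⁻ ξ : E, ENNReal.ofReal ((1 + ‖(2 * Real.pi) • ξ‖ ^ 2) ^ s) * ‖u ξ‖ₑ ^ 2) ^ (1 / 2 : ℝ)

/-- The inclusion `ℝᵐ ⊆ ℂᵐ` as a continuous linear map. -/
def complexifyCLM (m : ℕ) : Vec m →L[ℝ] EuclideanSpace ℂ (Fin m) :=
  LinearMap.toContinuousLinearMap
    { toFun := complexify
      map_add' := fun v w => by ext j; simp [complexify]
      map_smul' := fun c v => by ext j; simp [complexify] }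

theorem complexifyCLM_apply (v : Vec m) : complexifyCLM m v = complexify v := rfl

theorem continuous_of_continuous_complexify {X : Type*} [TopologicalSpace X] {h : X → Vec m}
    (hc : Continuous fun x => complexify (h x)) : Continuous h := by
  have : h = fun x => WithLp.toLp 2 fun j => (complexify (h x) j).re := by
    funext x; ext j; simp [complexify]
  rw [this]
  exact (PiLp.continuous_toLp 2 _).comp (continuous_pi fun j => Complex.continuous_re.comp
    ((EuclideanSpace.proj (𝕜 := ℂ) j).continuous.comp hc))

theorem lintegral_comp_const_smul (G : E → ℝ≥0∞) {r : ℝ} (hr : r ≠ 0) :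
    ∫⁻ x : E, G (r • x) = ENNReal.ofReal |(r ^ Module.finrank ℝ E)⁻¹| * ∫⁻ x, G x := by
  have h := lintegral_map_equiv (μ := (volume : Measure E)) G
    (Homeomorph.smulOfNeZero r hr).toMeasurableEquiv
  have h2 := Measure.map_addHaar_smul (volume : Measure E) hr
  have h3 : Measure.map (⇑(Homeomorph.smulOfNeZero (α := E) r hr).toMeasurableEquiv) volume
      = ENNReal.ofReal |(r ^ Module.finrank ℝ E)⁻¹| • (volume : Measure E) := h2
  rw [h3, lintegral_smul_measure] at h
  exact h.symm

/-- After the substitution ω = -2πξ, the Jacobian (2π)^d cancels the square of the normalising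
constant (2π)^{-d/2}. -/
theorem lintegral_unitaryFourier (s : ℝ) (F : Lp (EuclideanSpace ℂ (Fin m)) 2 (volume : Measure E)) :
    (∫⁻ ω : E, ENNReal.ofReal ((1 + ‖ω‖ ^ 2) ^ s) * ‖unitaryFourier F ω‖ₑ ^ 2) ^ (1 / 2 : ℝ)
      = weightedSpectralNorm s ((𝓕 F : Lp (EuclideanSpace ℂ (Fin m)) 2 (volume : Measure E)) : E → _) := by
  have hπ : (0 : ℝ) < 2 * Real.pi := by positivity
  have hr : -(2 * Real.pi)⁻¹ ≠ 0 := by simp [Real.pi_ne_zero]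
  set d := Module.finrank ℝ E
  set c : ℝ := (2 * Real.pi) ^ (-(d : ℝ) / 2)
  have hc0 : 0 ≤ c := by positivity
  have hc2 : c ^ 2 = ((2 * Real.pi) ^ d)⁻¹ := by
    rw [← Real.rpow_natCast, ← Real.rpow_mul hπ.le, ← Real.rpow_natCast (2 * Real.pi) d,
      ← Real.rpow_neg hπ.le]
    congr 1; push_cast; ring
  set U : E → EuclideanSpace ℂ (Fin m) :=
    ((𝓕 F : Lp (EuclideanSpace ℂ (Fin m)) 2 (volume : Measure E)) : E → _)
  unfold weightedSpectralNorm
  congr 1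
  have key := lintegral_comp_const_smul (fun ξ : E => ENNReal.ofReal (c ^ 2) *
    (ENNReal.ofReal ((1 + ‖(2 * Real.pi) • ξ‖ ^ 2) ^ s) * ‖U ξ‖ₑ ^ 2)) hr
  have hl : ∀ ω : E, ENNReal.ofReal ((1 + ‖ω‖ ^ 2) ^ s) * ‖unitaryFourier F ω‖ₑ ^ 2
      = ENNReal.ofReal (c ^ 2) * (ENNReal.ofReal
        ((1 + ‖(2 * Real.pi) • (-(2 * Real.pi)⁻¹ • ω)‖ ^ 2) ^ s) *
          ‖U (-(2 * Real.pi)⁻¹ • ω)‖ₑ ^ 2) := by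
    intro ω
    have h1 : (2 * Real.pi) • (-(2 * Real.pi)⁻¹ • ω) = -ω := by
      rw [smul_smul, mul_neg, mul_inv_cancel₀ hπ.ne', neg_one_smul]
    have h2 : ‖unitaryFourier F ω‖ₑ = ENNReal.ofReal c * ‖U (-(2 * Real.pi)⁻¹ • ω)‖ₑ := by
      unfold unitaryFourier
      rw [enorm_smul, Real.enorm_of_nonneg hc0]
    rw [h1, norm_neg, h2, mul_pow, ENNReal.ofReal_pow hc0]
    ring
  rw [lintegral_congr hl, key, lintegral_const_mul' _ _ ENNReal.ofReal_ne_top, ← mul_assoc,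
    ← ENNReal.ofReal_mul (abs_nonneg _), hc2]
  have : |((-(2 * Real.pi)⁻¹) ^ d)⁻¹| * ((2 * Real.pi) ^ d)⁻¹ = 1 := by
    rw [abs_inv, abs_pow, abs_neg, abs_inv, abs_of_pos hπ, inv_pow, inv_inv]
    exact mul_inv_cancel₀ (by positivity)
  rw [this]
  simp

theorem weightedSpectralNorm_congr_ae (s : ℝ) {u v : E → EuclideanSpace ℂ (Fin m)}
    (h : u =ᵐ[volume] v) : weightedSpectralNorm s u = weightedSpectralNorm s v := by
  unfold weightedSpectralNorm
  congr 1
  refine lintegral_congr_ae ?_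
  filter_upwards [h] with ξ hξ
  rw [hξ]

theorem HasSpectrum.continuous_complexify {h : E → Vec m} {u : E → EuclideanSpace ℂ (Fin m)}
    (H : HasSpectrum h u) : Continuous fun x => complexify (h x) := by
  rw [funext H.eq_fourierInv]
  exact continuous_fourierInv_of_integrable H.integrable

/-- Almost everywhere h is the L² inverse transform of u, so Fourier inversion returns u as its
transform. Norms of composed functions can thus be read off any explicit spectrum, finite or not. -/
theorem HasSpectrum.sobolevNorm_eq {h : E → Vec m} {u : E → EuclideanSpace ℂ (Fin m)}
    (H : HasSpectrum h u) (s : ℝ) : sobolevNorm s h = weightedSpectralNorm s u := by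
  have hae := Lp_fourierInv_toLp_ae_eq H.integrable H.memLp
  have hae' : (fun x => complexify (h x)) =ᵐ[volume]
      ((𝓕⁻ H.memLp.toLp : Lp (EuclideanSpace ℂ (Fin m)) 2 (volume : Measure E)) : E → _) := by
    rw [funext H.eq_fourierInv]; exact hae.symm
  have hmem : MemLp (fun x => complexify (h x)) 2 (volume : Measure E) :=
    (memLp_congr_ae hae').2 (Lp.memLp (𝓕⁻ H.memLp.toLp))
  have hcond := And.intro (continuous_of_continuous_complexify H.continuous_complexify) hmem
  rw [sobolevNorm, dif_pos hcond, lintegral_unitaryFourier]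
  have hF : hmem.toLp = (𝓕⁻ H.memLp.toLp : Lp (EuclideanSpace ℂ (Fin m)) 2 (volume : Measure E)) := by
    rw [← Lp.toLp_coeFn (𝓕⁻ H.memLp.toLp) (Lp.memLp _)]
    exact (MemLp.toLp_eq_toLp_iff _ _).2 hae'
  have : (𝓕 hcond.2.toLp : Lp (EuclideanSpace ℂ (Fin m)) 2 (volume : Measure E))
      = H.memLp.toLp := by
    rw [hF, fourier_fourierInv_eq]
  rw [this]
  exact weightedSpectralNorm_congr_ae s H.memLp.coeFn_toLp

theorem integrable_sobolevWeight {s : ℝ} (hs : (Module.finrank ℝ E : ℝ) / 2 < s) :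
    Integrable fun ω : E => (1 + ‖ω‖ ^ 2) ^ (-s) := by
  have := integrable_rpow_neg_one_add_norm_sq (μ := (volume : Measure E)) (r := 2 * s) (by linarith)
  simpa [neg_div] using this

/-- A function of finite weighted `L²` norm of order `s > dim E / 2` is integrable. -/
theorem integrable_of_weightedSpectralNorm_lt_top {s : ℝ} (hs : (Module.finrank ℝ E : ℝ) / 2 < s)
    {u : E → EuclideanSpace ℂ (Fin m)} (hu : AEStronglyMeasurable u)
    (h : weightedSpectralNorm s u < ∞) : Integrable u := by
  have hπ : (2 * Real.pi) ≠ 0 := by positivity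
  have hw : Integrable fun ξ : E => (1 + ‖(2 * Real.pi) • ξ‖ ^ 2) ^ (-s) :=
    (integrable_sobolevWeight hs).comp_smul hπ
  have hI : ∫⁻ ξ : E, ENNReal.ofReal ((1 + ‖(2 * Real.pi) • ξ‖ ^ 2) ^ s) * ‖u ξ‖ₑ ^ 2 < ∞ := by
    by_contra hcon
    rw [not_lt, top_le_iff] at hcon
    rw [weightedSpectralNorm, hcon, ENNReal.top_rpow_of_pos (by norm_num)] at h
    exact lt_irrefl _ h
  refine ⟨hu, ?_⟩
  -- An AM–GM bound t ≤ b⁻¹ + b·t², with b the Sobolev weight. The first term is integrable because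
  -- s > dim/2, the second by hypothesis.
  have hpt : ∀ ξ : E, ‖u ξ‖ₑ ≤ ENNReal.ofReal ((1 + ‖(2 * Real.pi) • ξ‖ ^ 2) ^ (-s)) +
      ENNReal.ofReal ((1 + ‖(2 * Real.pi) • ξ‖ ^ 2) ^ s) * ‖u ξ‖ₑ ^ 2 := by
    intro ξ
    have hb : 0 < 1 + ‖(2 * Real.pi) • ξ‖ ^ 2 := by positivity
    set b := (1 + ‖(2 * Real.pi) • ξ‖ ^ 2) ^ s with hbdef
    have hbp : 0 < b := Real.rpow_pos_of_pos hb s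
    rw [Real.rpow_neg hb.le, ← hbdef, ← ofReal_norm, ← ENNReal.ofReal_pow (norm_nonneg _),
      ← ENNReal.ofReal_mul hbp.le, ← ENNReal.ofReal_add (by positivity) (by positivity)]
    refine ENNReal.ofReal_le_ofReal ?_
    have h1 : b⁻¹ * b = 1 := inv_mul_cancel₀ hbp.ne'
    have h2 : 0 < b⁻¹ := inv_pos.2 hbp
    have h3 : b⁻¹ + b * ‖u ξ‖ ^ 2 - ‖u ξ‖ = b⁻¹ * ((1 - b * ‖u ξ‖ / 2) ^ 2 + 3 / 4 * (b * ‖u ξ‖) ^ 2) := by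
      field_simp; ring
    have : 0 ≤ b⁻¹ + b * ‖u ξ‖ ^ 2 - ‖u ξ‖ := by rw [h3]; positivity
    linarith
  refine (lintegral_mono hpt).trans_lt ?_
  rw [lintegral_add_left' (by
    refine (Measurable.ennreal_ofReal ?_).aemeasurable
    fun_prop)]
  exact ENNReal.add_lt_top.2 ⟨hw.lintegral_lt_top, hI⟩

/-- The spectrum is the L² transform, integrable since s > dim/2. Inversion holds almost everywhere,
hence everywhere because both sides are continuous. -/
theorem exists_hasSpectrum {s : ℝ} (hs : (Module.finrank ℝ E : ℝ) / 2 < s) {h : E → Vec m}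
    (hh : sobolevNorm s h < ∞) : ∃ u, HasSpectrum h u := by
  by_cases hcond : Continuous h ∧ MemLp (fun x => complexify (h x)) 2 (volume : Measure E)
  swap
  · rw [sobolevNorm, dif_neg hcond] at hh
    exact absurd hh (lt_irrefl _)
  rw [sobolevNorm, dif_pos hcond, lintegral_unitaryFourier] at hh
  set U := (𝓕 hcond.2.toLp : Lp (EuclideanSpace ℂ (Fin m)) 2 (volume : Measure E)) with hU
  have h1 : Integrable (U : E → _) :=
    integrable_of_weightedSpectralNorm_lt_top hs (Lp.aestronglyMeasurable U) hh
  have h2 : MemLp (U : E → _) 2 := Lp.memLp U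
  refine ⟨U, h1, h2, ?_⟩
  have hae := Lp_fourierInv_toLp_ae_eq h1 h2
  rw [Lp.toLp_coeFn, hU, fourierInv_fourier_eq, ← hU] at hae
  have := hcond.2.coeFn_toLp.symm.trans hae
  exact congrFun ((Continuous.ae_eq_iff_eq volume
    ((complexifyCLM m).continuous.comp hcond.1)
    (continuous_fourierInv_of_integrable h1)).1 this)

end Spectrum

/-! ### Trigonometric polynomials that represent point evaluations. -/

section TrigonometricSums

variable {E : Type*} [NormedAddCommGroup E] [InnerProductSpace ℝ E] {m : ℕ}

theorem inner_complexify (v w : Vec m) :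
    inner ℂ (complexify v) (complexify w) = ((inner ℝ v w : ℝ) : ℂ) := by
  simp [complexify, PiLp.inner_apply]

/-- The trigonometric polynomial `∑ᵢ exp(-2πi ⟨ξ, xᵢ⟩) cᵢ`. -/
def trigSum {n : ℕ} (x : Fin n → E) (c : Fin n → Vec m) (ξ : E) : EuclideanSpace ℂ (Fin m) :=
  ∑ i, Complex.exp (-(((2 * Real.pi * inner ℝ ξ (x i) : ℝ) : ℂ) * Complex.I)) • complexify (c i)

theorem conj_exp_neg_mul_I (α : ℝ) :
    (starRingEnd ℂ) (Complex.exp (-((α : ℂ) * Complex.I))) = Complex.exp ((α : ℂ) * Complex.I) := by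
  rw [← Complex.exp_conj]
  simp

theorem norm_trigSum_sq {n : ℕ} (x : Fin n → E) (c : Fin n → Vec m) (ξ : E) :
    ‖trigSum x c ξ‖ ^ 2 = ∑ i, ∑ j,
      Real.cos (2 * Real.pi * inner ℝ ξ (x i) - 2 * Real.pi * inner ℝ ξ (x j)) *
        inner ℝ (c i) (c j) := by
  rw [← inner_self_eq_norm_sq (𝕜 := ℂ), trigSum, sum_inner, map_sum]
  refine Finset.sum_congr rfl fun i _ => ?_
  rw [inner_sum, map_sum]
  refine Finset.sum_congr rfl fun j _ => ?_
  rw [inner_smul_left, inner_smul_right, inner_complexify, conj_exp_neg_mul_I, ← mul_assoc,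
    ← Complex.exp_add, ← sub_eq_add_neg, ← sub_mul, ← Complex.ofReal_sub, RCLike.re_eq_complex_re,
    Complex.re_mul_ofReal, Complex.exp_ofReal_mul_I_re]

theorem continuous_trigSum {n : ℕ} (x : Fin n → E) (c : Fin n → Vec m) :
    Continuous (trigSum x c) := by
  unfold trigSum
  fun_prop

end TrigonometricSums

/-! ### The reproducing inequality of the scalar-kernel Sobolev space. -/

section Reproducing

variable {E : Type*} [NormedAddCommGroup E] [InnerProductSpace ℝ E] [FiniteDimensional ℝ E]
  [MeasurableSpace E] [BorelSpace E] {m : ℕ}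

theorem sobolevKernel_eq_integral (s : ℝ) (x y : E) :
    sobolevKernel s x y = ∫ ξ : E, (1 + ‖(2 * Real.pi) • ξ‖ ^ 2) ^ (-s) *
      Real.cos (2 * Real.pi * inner ℝ ξ x - 2 * Real.pi * inner ℝ ξ y) := by
  have h := Measure.integral_comp_smul (volume : Measure E)
    (fun ω : E => (1 + ‖ω‖ ^ 2) ^ (-s) * Real.cos (inner ℝ (x - y) ω)) (2 * Real.pi)
  have hπ : (0 : ℝ) < 2 * Real.pi := by positivity
  rw [sobolevKernel, Real.rpow_neg hπ.le, Real.rpow_natCast]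
  rw [abs_of_pos (by positivity), smul_eq_mul] at h
  rw [← h]
  refine integral_congr_ae (Filter.Eventually.of_forall fun ξ => ?_)
  simp only [inner_smul_right, real_inner_comm ξ, inner_sub_right]
  congr 2
  ring

theorem integral_weight_trigSum {s : ℝ} (hs : (Module.finrank ℝ E : ℝ) / 2 < s) {n : ℕ}
    (x : Fin n → E) (c : Fin n → Vec m) :
    Integrable (fun ξ : E => (1 + ‖(2 * Real.pi) • ξ‖ ^ 2) ^ (-s) * ‖trigSum x c ξ‖ ^ 2) ∧
    ∫ ξ : E, (1 + ‖(2 * Real.pi) • ξ‖ ^ 2) ^ (-s) * ‖trigSum x c ξ‖ ^ 2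
      = ∑ i, ∑ j, sobolevKernel s (x i) (x j) * inner ℝ (c i) (c j) := by
  have hπ : (2 * Real.pi) ≠ 0 := by positivity
  have hw : Integrable fun ξ : E => (1 + ‖(2 * Real.pi) • ξ‖ ^ 2) ^ (-s) :=
    (integrable_sobolevWeight hs).comp_smul hπ
  have hint : ∀ i j, Integrable fun ξ : E => (1 + ‖(2 * Real.pi) • ξ‖ ^ 2) ^ (-s) *
      Real.cos (2 * Real.pi * inner ℝ ξ (x i) - 2 * Real.pi * inner ℝ ξ (x j)) := by
    intro i j
    refine hw.mul_bdd (c := 1) (Continuous.aestronglyMeasurable (by fun_prop)) ?_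
    exact Filter.Eventually.of_forall fun ξ => Real.abs_cos_le_one _
  have heq : ∀ ξ : E, (1 + ‖(2 * Real.pi) • ξ‖ ^ 2) ^ (-s) * ‖trigSum x c ξ‖ ^ 2
      = ∑ i, ∑ j, (1 + ‖(2 * Real.pi) • ξ‖ ^ 2) ^ (-s) *
      Real.cos (2 * Real.pi * inner ℝ ξ (x i) - 2 * Real.pi * inner ℝ ξ (x j)) *
        inner ℝ (c i) (c j) := by
    intro ξ
    simp only [norm_trigSum_sq, Finset.mul_sum, mul_assoc]
  simp_rw [heq]
  refine ⟨integrable_finsetSum _ fun i _ => integrable_finsetSum _ fun j _ =>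
    (hint i j).mul_const _, ?_⟩
  rw [integral_finsetSum _ fun i _ => integrable_finsetSum _ fun j _ => (hint i j).mul_const _]
  refine Finset.sum_congr rfl fun i _ => ?_
  rw [integral_finsetSum _ fun j _ => (hint i j).mul_const _]
  refine Finset.sum_congr rfl fun j _ => ?_
  rw [integral_mul_const, sobolevKernel_eq_integral]

/-- The Sobolev kernel is positive semi-definite. -/
theorem sum_sobolevKernel_nonneg {s : ℝ} (hs : (Module.finrank ℝ E : ℝ) / 2 < s) {n : ℕ}
    (x : Fin n → E) (c : Fin n → Vec m) :
    0 ≤ ∑ i, ∑ j, sobolevKernel s (x i) (x j) * inner ℝ (c i) (c j) := by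
  rw [← (integral_weight_trigSum hs x c).2]
  exact integral_nonneg fun ξ => by positivity

theorem lintegral_weight_trigSum {s : ℝ} (hs : (Module.finrank ℝ E : ℝ) / 2 < s) {n : ℕ}
    (x : Fin n → E) (c : Fin n → Vec m) :
    ∫⁻ ξ : E, ENNReal.ofReal ((1 + ‖(2 * Real.pi) • ξ‖ ^ 2) ^ (-s)) * ‖trigSum x c ξ‖ₑ ^ 2
      = ENNReal.ofReal (∑ i, ∑ j, sobolevKernel s (x i) (x j) * inner ℝ (c i) (c j)) := by
  rw [← (integral_weight_trigSum hs x c).2,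
    ofReal_integral_eq_lintegral_ofReal (integral_weight_trigSum hs x c).1
      (Filter.Eventually.of_forall fun ξ => by positivity)]
  refine lintegral_congr fun ξ => ?_
  rw [ENNReal.ofReal_mul (by positivity), ENNReal.ofReal_pow (norm_nonneg _), ofReal_norm]

theorem HasSpectrum.sum_inner_eq_integral {h : E → Vec m} {u : E → EuclideanSpace ℂ (Fin m)}
    (H : HasSpectrum h u) {n : ℕ} (x : Fin n → E) (c : Fin n → Vec m) :
    ((∑ i, inner ℝ (c i) (h (x i)) : ℝ) : ℂ) = ∫ ξ, inner ℂ (trigSum x c ξ) (u ξ) := by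
  have hi : ∀ i, Integrable fun ξ : E =>
      Complex.exp (((2 * Real.pi * inner ℝ ξ (x i) : ℝ) : ℂ) * Complex.I) • u ξ := by
    intro i
    have hc : Continuous fun ξ : E =>
        Complex.exp (((2 * Real.pi * inner ℝ ξ (x i) : ℝ) : ℂ) * Complex.I) := by fun_prop
    refine H.integrable.mono
      (hc.aestronglyMeasurable.smul H.integrable.aestronglyMeasurable)
      (Filter.Eventually.of_forall fun ξ => ?_)
    rw [norm_smul, Complex.norm_exp_ofReal_mul_I, one_mul]
  have h1 : ∀ i, ((inner ℝ (c i) (h (x i)) : ℝ) : ℂ) =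
      ∫ ξ, inner ℂ (complexify (c i))
        (Complex.exp (((2 * Real.pi * inner ℝ ξ (x i) : ℝ) : ℂ) * Complex.I) • u ξ) := by
    intro i
    rw [integral_inner (hi i), ← inner_complexify, H.eq_fourierInv, Real.fourierInv_eq']
  push_cast
  rw [Finset.sum_congr rfl fun i _ => h1 i, ← integral_finsetSum _ fun i _ =>
    (hi i).const_inner _]
  refine integral_congr_ae (Filter.Eventually.of_forall fun ξ => ?_)
  simp only [trigSum, sum_inner]
  refine Finset.sum_congr rfl fun i _ => ?_
  rw [inner_smul_left, inner_smul_right, conj_exp_neg_mul_I]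

theorem ofReal_rpow_half_sq {b : ℝ} (hb : 0 ≤ b) (r : ℝ) :
    ENNReal.ofReal (b ^ (r / 2)) ^ 2 = ENNReal.ofReal (b ^ r) := by
  rw [← ENNReal.ofReal_pow (by positivity), ← Real.rpow_natCast, ← Real.rpow_mul hb]
  congr 2
  push_cast
  ring

/-- The reproducing inequality of the Sobolev space. -/
theorem sum_inner_le_sobolevNorm {s : ℝ} (hs : (Module.finrank ℝ E : ℝ) / 2 < s)
    (h : E → Vec m) (hh : sobolevNorm s h < ∞) {n : ℕ} (x : Fin n → E) (c : Fin n → Vec m) :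
    ENNReal.ofReal |∑ i, inner ℝ (c i) (h (x i))| ≤
      ENNReal.ofReal (Real.sqrt (∑ i, ∑ j, sobolevKernel s (x i) (x j) * inner ℝ (c i) (c j))) *
        sobolevNorm s h := by
  obtain ⟨u, H⟩ := exists_hasSpectrum hs hh
  have hsqrt : ∀ t : ℝ, ENNReal.ofReal (Real.sqrt t) = ENNReal.ofReal t ^ (1 / 2 : ℝ) := by
    intro t
    rcases le_total 0 t with ht | ht
    · rw [Real.sqrt_eq_rpow, ENNReal.ofReal_rpow_of_nonneg ht (by norm_num)]
    · rw [Real.sqrt_eq_zero_of_nonpos ht, ENNReal.ofReal_of_nonpos ht]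
      simp
  rw [H.sobolevNorm_eq, hsqrt, ← lintegral_weight_trigSum hs]
  have habs : ENNReal.ofReal |∑ i, inner ℝ (c i) (h (x i))| =
      ‖∫ ξ, inner ℂ (trigSum x c ξ) (u ξ)‖ₑ := by
    rw [← H.sum_inner_eq_integral, ← ofReal_norm, Complex.norm_real, Real.norm_eq_abs]
  rw [habs]
  refine (enorm_integral_le_lintegral_enorm _).trans ?_
  have hpos : ∀ ξ : E, 0 < 1 + ‖(2 * Real.pi) • ξ‖ ^ 2 := fun ξ => by positivity
  -- The weight is split as w^{-s/2}·w^{s/2}: Hölder then yields the kernel quadratic form from `f`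
  -- and the Sobolev norm from `g`.
  set f : E → ℝ≥0∞ := fun ξ =>
    ENNReal.ofReal ((1 + ‖(2 * Real.pi) • ξ‖ ^ 2) ^ (-s / 2)) * ‖trigSum x c ξ‖ₑ
  set g : E → ℝ≥0∞ := fun ξ =>
    ENNReal.ofReal ((1 + ‖(2 * Real.pi) • ξ‖ ^ 2) ^ (s / 2)) * ‖u ξ‖ₑ
  have hfg : ∀ ξ, ‖inner ℂ (trigSum x c ξ) (u ξ)‖ₑ ≤ (f * g) ξ := by
    intro ξ
    have h1 : ENNReal.ofReal ((1 + ‖(2 * Real.pi) • ξ‖ ^ 2) ^ (-s / 2)) *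
        ENNReal.ofReal ((1 + ‖(2 * Real.pi) • ξ‖ ^ 2) ^ (s / 2)) = 1 := by
      rw [← ENNReal.ofReal_mul (by positivity), ← Real.rpow_add (hpos ξ)]
      simp [neg_div]
    have h2 : (f * g) ξ = ‖trigSum x c ξ‖ₑ * ‖u ξ‖ₑ := by
      simp only [f, g, Pi.mul_apply]
      rw [mul_mul_mul_comm, h1, one_mul]
    rw [h2, ← ofReal_norm, ← ofReal_norm, ← ofReal_norm, ← ENNReal.ofReal_mul (norm_nonneg _)]
    exact ENNReal.ofReal_le_ofReal (norm_inner_le_norm _ _)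
  have hw : ∀ r : ℝ, Measurable fun ξ : E =>
      ENNReal.ofReal ((1 + ‖(2 * Real.pi) • ξ‖ ^ 2) ^ r) := by
    intro r
    refine Measurable.ennreal_ofReal ?_
    fun_prop
  have hf : AEMeasurable f :=
    (hw _).aemeasurable.mul (continuous_trigSum x c).aestronglyMeasurable.enorm
  have hg : AEMeasurable g := (hw _).aemeasurable.mul H.integrable.aestronglyMeasurable.enorm
  refine (lintegral_mono hfg).trans
    ((ENNReal.lintegral_mul_le_Lp_mul_Lq volume Real.HolderConjugate.two_two hf hg).trans ?_)
  refine le_of_eq ?_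
  unfold weightedSpectralNorm
  congr 2
  · refine lintegral_congr fun ξ => ?_
    simp only [f]
    rw [ENNReal.rpow_two, mul_pow, ofReal_rpow_half_sq (hpos ξ).le]
  · refine lintegral_congr fun ξ => ?_
    simp only [g]
    rw [ENNReal.rpow_two, mul_pow, ofReal_rpow_half_sq (hpos ξ).le]

end Reproducing

/-! ### Translations and linear maps on the Fourier side. -/

section Composition

variable {E F : Type*} [NormedAddCommGroup E] [InnerProductSpace ℝ E] [FiniteDimensional ℝ E]
  [MeasurableSpace E] [BorelSpace E] [NormedAddCommGroup F] [InnerProductSpace ℝ F]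
  [FiniteDimensional ℝ F] [MeasurableSpace F] [BorelSpace F] {m : ℕ}

theorem HasSpectrum.comp_add {h : E → Vec m} {u : E → EuclideanSpace ℂ (Fin m)}
    (H : HasSpectrum h u) (a : E) :
    HasSpectrum (fun x => h (x + a))
      (fun ξ => Complex.exp (((2 * Real.pi * inner ℝ ξ a : ℝ) : ℂ) * Complex.I) • u ξ) := by
  have hc : Continuous fun ξ : E =>
      Complex.exp (((2 * Real.pi * inner ℝ ξ a : ℝ) : ℂ) * Complex.I) := by fun_prop
  have hm : AEStronglyMeasurable (fun ξ : E =>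
      Complex.exp (((2 * Real.pi * inner ℝ ξ a : ℝ) : ℂ) * Complex.I) • u ξ) volume :=
    hc.aestronglyMeasurable.smul H.integrable.aestronglyMeasurable
  have hn : ∀ ξ : E, ‖Complex.exp (((2 * Real.pi * inner ℝ ξ a : ℝ) : ℂ) * Complex.I) • u ξ‖
      = ‖u ξ‖ := by
    intro ξ
    rw [norm_smul, Complex.norm_exp_ofReal_mul_I, one_mul]
  refine ⟨H.integrable.mono hm (Filter.Eventually.of_forall fun ξ => (hn ξ).le),
    H.memLp.mono hm (Filter.Eventually.of_forall fun ξ => (hn ξ).le), fun x => ?_⟩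
  rw [H.eq_fourierInv, Real.fourierInv_eq', Real.fourierInv_eq']
  refine integral_congr_ae (Filter.Eventually.of_forall fun ξ => ?_)
  simp only [smul_smul, ← Complex.exp_add, inner_add_right]
  congr 2
  push_cast
  ring

theorem sobolevNorm_comp_add {s : ℝ} (hs : (Module.finrank ℝ E : ℝ) / 2 < s)
    (h : E → Vec m) (a : E) : sobolevNorm s (fun x => h (x + a)) ≤ sobolevNorm s h := by
  by_cases hh : sobolevNorm s h < ∞
  · obtain ⟨u, H⟩ := exists_hasSpectrum hs hh
    rw [H.sobolevNorm_eq, (H.comp_add a).sobolevNorm_eq]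
    refine le_of_eq ?_
    unfold weightedSpectralNorm
    congr 1
    refine lintegral_congr fun ξ => ?_
    rw [enorm_smul, ← ofReal_norm (Complex.exp _), Complex.norm_exp_ofReal_mul_I]
    simp
  · rw [not_lt, top_le_iff] at hh
    rw [hh]
    exact le_top

theorem lintegral_comp_equiv_of_map_eq {S : F ≃L[ℝ] E} {J : ℝ} (hJ : 0 < J)
    (hS : Measure.map S (volume : Measure F) = ENNReal.ofReal J⁻¹ • volume) (G : E → ℝ≥0∞) :
    ∫⁻ η, G η = ENNReal.ofReal J * ∫⁻ ξ, G (S ξ) := by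
  have h := lintegral_map_equiv (μ := (volume : Measure F)) G S.toHomeomorph.toMeasurableEquiv
  have h3 : Measure.map (⇑S.toHomeomorph.toMeasurableEquiv) (volume : Measure F)
      = ENNReal.ofReal J⁻¹ • volume := hS
  rw [h3, lintegral_smul_measure] at h
  change _ = ∫⁻ ξ, G (S ξ) at h
  rw [← h, smul_eq_mul, ← mul_assoc, ← ENNReal.ofReal_mul hJ.le, mul_inv_cancel₀ hJ.ne']
  simp

/-- The adjoint relation moves `T` from the argument of h to the frequency. Substituting η = Sξ in
the inverse Fourier integral then produces the factor J⁻¹. -/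
theorem HasSpectrum.comp_linear {h : F → Vec m} {u : F → EuclideanSpace ℂ (Fin m)}
    (H : HasSpectrum h u) {T : E → F} {S : F ≃L[ℝ] E} {J : ℝ} (hJ : 0 < J)
    (hTS : ∀ x ξ, (inner ℝ ξ (T x) : ℝ) = inner ℝ (S ξ) x)
    (hS : Measure.map S (volume : Measure F) = ENNReal.ofReal J⁻¹ • volume) :
    HasSpectrum (h ∘ T) (fun η => J⁻¹ • u (S.symm η)) := by
  have hv : (volume : Measure E) = ENNReal.ofReal J • Measure.map S (volume : Measure F) := by
    rw [hS, smul_smul, ← ENNReal.ofReal_mul hJ.le, mul_inv_cancel₀ hJ.ne']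
    simp
  have hemb : MeasurableEmbedding S := S.toHomeomorph.measurableEmbedding
  have hcomp : (fun η => u (S.symm η)) ∘ S = u := by
    funext ξ
    simp
  have h1 : Integrable (fun η => u (S.symm η)) := by
    rw [hv]
    refine Integrable.smul_measure ?_ ENNReal.ofReal_ne_top
    rw [hemb.integrable_map_iff, hcomp]
    exact H.integrable
  have h2 : MemLp (fun η => u (S.symm η)) 2 := by
    rw [hv]
    refine MemLp.smul_measure ?_ ENNReal.ofReal_ne_top
    rw [hemb.memLp_map_measure_iff, hcomp]
    exact H.memLp
  refine ⟨h1.smul J⁻¹, h2.const_smul J⁻¹, fun x => ?_⟩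
  have hI : ∀ G : E → EuclideanSpace ℂ (Fin m), ∫ η, G η = J • ∫ ξ, G (S ξ) := by
    intro G
    conv_lhs => rw [hv]
    rw [integral_smul_measure, hemb.integral_map, ENNReal.toReal_ofReal hJ.le]
  rw [Function.comp_apply, H.eq_fourierInv, Real.fourierInv_eq', Real.fourierInv_eq', hI,
    ← integral_smul]
  refine integral_congr_ae (Filter.Eventually.of_forall fun ξ => ?_)
  simp only [ContinuousLinearEquiv.symm_apply_apply, hTS]
  rw [smul_comm _ J⁻¹, smul_smul, mul_inv_cancel₀ hJ.ne', one_smul]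

theorem ofReal_rpow_eq_ratio_mul {a b : ℝ} (ha : 0 < a) (hb : 0 < b) (s : ℝ) :
    ENNReal.ofReal (a ^ s) = ENNReal.ofReal (|a / b| ^ (s / 2)) ^ 2 * ENNReal.ofReal (b ^ s) := by
  rw [ofReal_rpow_half_sq (abs_nonneg _), ← ENNReal.ofReal_mul (by positivity),
    abs_of_pos (div_pos ha hb), Real.div_rpow ha.le hb.le,
    div_mul_cancel₀ _ (Real.rpow_pos_of_pos hb s).ne']

/-- Norm of the composition operator with an injective linear map, expressed with the adjoint `S`
of the map and the Jacobian `J`. -/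
theorem sobolevNorm_comp_linear_le {s : ℝ} (hs : (Module.finrank ℝ F : ℝ) / 2 < s)
    {h : F → Vec m} (hh : sobolevNorm s h < ∞) {T : E → F} {S : F ≃L[ℝ] E} {J : ℝ} (hJ : 0 < J)
    (hTS : ∀ x ξ, (inner ℝ ξ (T x) : ℝ) = inner ℝ (S ξ) x)
    (hS : Measure.map S (volume : Measure F) = ENNReal.ofReal J⁻¹ • volume) :
    sobolevNorm s (h ∘ T) ≤
      (⨆ ω : F, ENNReal.ofReal (|(1 + ‖S ω‖ ^ 2) / (1 + ‖ω‖ ^ 2)| ^ (s / 2))) *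
        ENNReal.ofReal (1 / J ^ (1 / 2 : ℝ)) * sobolevNorm s h := by
  obtain ⟨u, H⟩ := exists_hasSpectrum hs hh
  rw [H.sobolevNorm_eq, (H.comp_linear hJ hTS hS).sobolevNorm_eq]
  set K := ⨆ ω : F, ENNReal.ofReal (|(1 + ‖S ω‖ ^ 2) / (1 + ‖ω‖ ^ 2)| ^ (s / 2))
  unfold weightedSpectralNorm
  have hJ2 : ENNReal.ofReal (1 / J ^ (1 / 2 : ℝ)) = (ENNReal.ofReal J⁻¹) ^ (1 / 2 : ℝ) := by
    rw [ENNReal.ofReal_rpow_of_nonneg (by positivity) (by norm_num), Real.inv_rpow hJ.le, one_div]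
  have hK2 : K = (K ^ 2) ^ (1 / 2 : ℝ) := by
    rw [← ENNReal.rpow_two, ← ENNReal.rpow_mul]
    norm_num
  rw [hJ2, hK2, ← ENNReal.mul_rpow_of_nonneg _ _ (by norm_num),
    ← ENNReal.mul_rpow_of_nonneg _ _ (by norm_num)]
  refine ENNReal.rpow_le_rpow ?_ (by norm_num)
  rw [lintegral_comp_equiv_of_map_eq hJ hS]
  -- As `S` is linear, the factor 2π of the normalisation is absorbed by evaluating the supremum `K`
  -- at ω = 2πξ.
  have hpt : ∀ ξ : F, ENNReal.ofReal ((1 + ‖(2 * Real.pi) • S ξ‖ ^ 2) ^ s) *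
      ‖J⁻¹ • u (S.symm (S ξ))‖ₑ ^ 2 ≤ (ENNReal.ofReal J⁻¹ ^ 2 * K ^ 2) *
        (ENNReal.ofReal ((1 + ‖(2 * Real.pi) • ξ‖ ^ 2) ^ s) * ‖u ξ‖ₑ ^ 2) := by
    intro ξ
    rw [S.symm_apply_apply, enorm_smul, Real.enorm_of_nonneg (by positivity), mul_pow,
      ← map_smul, ofReal_rpow_eq_ratio_mul (b := 1 + ‖(2 * Real.pi) • ξ‖ ^ 2)
        (by positivity) (by positivity)]
    have hle : ENNReal.ofReal (|(1 + ‖S ((2 * Real.pi) • ξ)‖ ^ 2) /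
        (1 + ‖(2 * Real.pi) • ξ‖ ^ 2)| ^ (s / 2)) ≤ K :=
      le_iSup (fun ω : F => ENNReal.ofReal (|(1 + ‖S ω‖ ^ 2) / (1 + ‖ω‖ ^ 2)| ^ (s / 2)))
        ((2 * Real.pi) • ξ)
    calc _ ≤ (K ^ 2 * ENNReal.ofReal ((1 + ‖(2 * Real.pi) • ξ‖ ^ 2) ^ s)) *
          (ENNReal.ofReal J⁻¹ ^ 2 * ‖u ξ‖ₑ ^ 2) := by gcongr
      _ = _ := by ring
  have hmeas : AEMeasurable fun ξ : F =>
      ENNReal.ofReal ((1 + ‖(2 * Real.pi) • ξ‖ ^ 2) ^ s) * ‖u ξ‖ₑ ^ 2 := by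
    refine AEMeasurable.mul (Measurable.aemeasurable ?_)
      (H.integrable.aestronglyMeasurable.enorm.pow_const 2)
    refine Measurable.ennreal_ofReal ?_
    fun_prop
  refine (mul_le_mul_right (lintegral_mono hpt) _).trans (le_of_eq ?_)
  rw [lintegral_const_mul'' _ hmeas]
  have hJJ : ENNReal.ofReal J * ENNReal.ofReal J⁻¹ = 1 := by
    rw [← ENNReal.ofReal_mul hJ.le, mul_inv_cancel₀ hJ.ne', ENNReal.ofReal_one]
  calc _ = (ENNReal.ofReal J * ENNReal.ofReal J⁻¹) * (K ^ 2 * ENNReal.ofReal J⁻¹ *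
        ∫⁻ ξ : F, ENNReal.ofReal ((1 + ‖(2 * Real.pi) • ξ‖ ^ 2) ^ s) * ‖u ξ‖ₑ ^ 2) := by ring
    _ = _ := by rw [hJJ, one_mul]

end Composition

/-! ### Injective weight matrices and the Jacobian of Wᵀ on R(W). -/

section Weights

variable {k k' m : ℕ}

theorem inner_linMap_right (W : Matrix (Fin k') (Fin k) ℝ) (x : Vec k) (y : Vec k') :
    (inner ℝ y (linMap W x) : ℝ) = inner ℝ (linMap Wᵀ y) x := by
  simp only [EuclideanSpace.inner_eq_star_dotProduct, Matrix.toLpLin_apply, star_trivial]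
  rw [Matrix.mulVec_transpose, dotProduct_comm, Matrix.dotProduct_mulVec, dotProduct_comm]

theorem linMap_mul_apply {k'' : ℕ} (V : Matrix (Fin k'') (Fin k') ℝ) (W : Matrix (Fin k') (Fin k) ℝ)
    (x : Vec k) : linMap (V * W) x = linMap V (linMap W x) := by
  simp [Matrix.toLpLin_apply, Matrix.mulVec_mulVec]

theorem det_linMap (A : Matrix (Fin k) (Fin k) ℝ) : LinearMap.det (linMap A) = A.det := by
  rw [linMap, Matrix.toEuclideanLin_eq_toLin_orthonormal, LinearMap.det_toLin]

theorem det_transpose_mul_self_nonneg (W : Matrix (Fin k') (Fin k) ℝ) : 0 ≤ (Wᵀ * W).det := by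
  have := (Matrix.posSemidef_conjTranspose_mul_self W).det_nonneg
  rwa [Matrix.conjTranspose_eq_transpose_of_trivial] at this

theorem det_pos_of_mem_weightSet {C D : ℝ} (hD : 0 < D) {W : Matrix (Fin k') (Fin k) ℝ}
    (hW : W ∈ weightSet C D k k') : 0 < (Wᵀ * W).det := by
  refine lt_of_le_of_ne (det_transpose_mul_self_nonneg W) fun h => ?_
  have := hW.2.2
  rw [← h, Real.zero_rpow (by norm_num)] at this
  linarith

theorem LinearMap.det_adjoint_real {E : Type*} [NormedAddCommGroup E] [InnerProductSpace ℝ E]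
    [FiniteDimensional ℝ E] (f : E →ₗ[ℝ] E) :
    LinearMap.det (LinearMap.adjoint f) = LinearMap.det f := by
  rw [← LinearMap.det_toMatrix (stdOrthonormalBasis ℝ E).toBasis,
    ← LinearMap.det_toMatrix (stdOrthonormalBasis ℝ E).toBasis, LinearMap.toMatrix_adjoint,
    Matrix.conjTranspose_eq_transpose_of_trivial, Matrix.det_transpose]

theorem injective_linMap {W : Matrix (Fin k') (Fin k) ℝ} (hW : 0 < (Wᵀ * W).det) :
    Function.Injective (linMap W) := by
  have hdet : LinearMap.det (linMap (Wᵀ * W)) ≠ 0 := by rw [det_linMap]; exact hW.ne'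
  intro x y hxy
  refine (LinearMap.equivOfDetNeZero _ hdet).injective ?_
  change linMap (Wᵀ * W) x = linMap (Wᵀ * W) y
  rw [linMap_mul_apply, linMap_mul_apply, hxy]

theorem finrank_range_linMap {W : Matrix (Fin k') (Fin k) ℝ} (hW : 0 < (Wᵀ * W).det) :
    Module.finrank ℝ (LinearMap.range (linMap W)) = k := by
  rw [LinearMap.finrank_range_of_inj (injective_linMap hW), finrank_euclideanSpace_fin]

/-- The transpose of an injective matrix, restricted to the range of the matrix, is an
isomorphism, with Jacobian `det(Wᵀ W)^{1/2}`. -/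
theorem exists_transposeEquiv {W : Matrix (Fin k') (Fin k) ℝ} (hW : 0 < (Wᵀ * W).det) :
    ∃ S : LinearMap.range (linMap W) ≃L[ℝ] Vec k,
      (∀ ω, S ω = linMap Wᵀ (ω : Vec k')) ∧
      Measure.map S (volume : Measure (LinearMap.range (linMap W))) =
        ENNReal.ofReal (Real.sqrt (Wᵀ * W).det)⁻¹ • volume := by
  have hdet : LinearMap.det (linMap (Wᵀ * W)) ≠ 0 := by rw [det_linMap]; exact hW.ne'
  set T : Vec k ≃ₗ[ℝ] LinearMap.range (linMap W) :=
    LinearEquiv.ofInjective (linMap W) (injective_linMap hW)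
  have hT : ∀ x, ((T x : LinearMap.range (linMap W)) : Vec k') = linMap W x := fun x => rfl
  set P : Vec k ≃ₗ[ℝ] Vec k := LinearMap.equivOfDetNeZero _ hdet
  have hP : ∀ x, P x = linMap (Wᵀ * W) x := fun x => rfl
  set S : LinearMap.range (linMap W) ≃L[ℝ] Vec k := (T.symm.trans P).toContinuousLinearEquiv
  have hS : ∀ ω, S ω = linMap Wᵀ (ω : Vec k') := by
    intro ω
    change P (T.symm ω) = _
    rw [hP, linMap_mul_apply, ← hT, T.apply_symm_apply]
  refine ⟨S, hS, ?_⟩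
  set Q : LinearMap.range (linMap W) ≃ₗᵢ[ℝ] Vec k :=
    ((stdOrthonormalBasis ℝ (LinearMap.range (linMap W))).reindex
      (finCongr (finrank_range_linMap hW))).repr
  set A : Vec k →ₗ[ℝ] Vec k := S.toLinearMap ∘ₗ Q.symm.toLinearMap
  set B : Vec k →ₗ[ℝ] Vec k := Q.toLinearMap ∘ₗ T.toLinearMap
  have hA : ∀ y, A y = S (Q.symm y) := fun y => rfl
  have hB : ∀ y, B y = Q (T y) := fun y => rfl
  -- In orthonormal coordinates on R(W), `A` is the restricted Wᵀ and `B` is W. Being adjoint they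
  -- have the same determinant, and A ∘ B = WᵀW, so (det A)² = det(WᵀW).
  have hadj : B = LinearMap.adjoint A := by
    rw [LinearMap.eq_adjoint_iff]
    intro x y
    rw [hA, hB, hS, real_inner_comm _ x, ← inner_linMap_right, ← hT]
    change inner ℝ (Q (T x)) y = inner ℝ (Q.symm y) (T x)
    rw [real_inner_comm, ← Q.inner_map_map, Q.apply_symm_apply]
  have hAB : A ∘ₗ B = linMap (Wᵀ * W) := by
    ext1 x
    rw [LinearMap.comp_apply, hA, hB, Q.symm_apply_apply, hS, hT, linMap_mul_apply]
  have hdetA : LinearMap.det A * LinearMap.det A = (Wᵀ * W).det := by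
    rw [← det_linMap, ← hAB, LinearMap.det_comp, hadj, LinearMap.det_adjoint_real]
  have hdetA0 : LinearMap.det A ≠ 0 := by
    intro h
    rw [h, mul_zero] at hdetA
    exact hW.ne hdetA
  have hsqrt : Real.sqrt (Wᵀ * W).det = |LinearMap.det A| := by
    rw [← hdetA, Real.sqrt_mul_self_eq_abs]
  have hfun : (S : LinearMap.range (linMap W) → Vec k) = A ∘ Q := by
    funext ω
    rw [Function.comp_apply, hA, Q.symm_apply_apply]
  rw [hfun, ← Measure.map_map A.continuous_of_finiteDimensional.measurable
    Q.continuous.measurable, Q.measurePreserving.map_eq,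
    Measure.map_linearMap_addHaar_eq_smul_addHaar _ hdetA0, hsqrt, abs_inv]

/-- At ω = 0 the ratio is 1. Nonvanishing keeps the bounds valid when the norm on R(W) is infinite,
where 0·∞ = 0 would break them. -/
theorem weightFactor_ne_zero (s : ℝ) {W : Matrix (Fin k') (Fin k) ℝ} (hW : 0 < (Wᵀ * W).det) :
    weightFactor s W ≠ 0 := by
  refine mul_ne_zero (fun h => ?_) (ne_of_gt (ENNReal.ofReal_pos.2 (by positivity)))
  have h0 := ENNReal.iSup_eq_zero.1 (ENNReal.iSup_eq_zero.1 h 0) (Submodule.zero_mem _)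
  simp at h0

theorem weightFactor_ne_top {s : ℝ} (hs : 0 ≤ s) (W : Matrix (Fin k') (Fin k) ℝ) :
    weightFactor s W ≠ ∞ := by
  refine ENNReal.mul_ne_top (ne_top_of_le_ne_top (ENNReal.ofReal_ne_top (r :=
    (1 + ‖(linMap Wᵀ).toContinuousLinearMap‖ ^ 2) ^ (s / 2))) ?_) ENNReal.ofReal_ne_top
  refine iSup₂_le fun ω _ => ENNReal.ofReal_le_ofReal ?_
  have h := (linMap Wᵀ).toContinuousLinearMap.le_opNorm ω
  change ‖linMap Wᵀ ω‖ ≤ _ at h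
  have h2 : ‖linMap Wᵀ ω‖ ^ 2 ≤ ‖(linMap Wᵀ).toContinuousLinearMap‖ ^ 2 * ‖ω‖ ^ 2 := by
    rw [← mul_pow]
    exact pow_le_pow_left₀ (norm_nonneg _) h 2
  rw [abs_of_pos (by positivity)]
  refine Real.rpow_le_rpow (by positivity) ?_ (by positivity)
  rw [div_le_iff₀ (by positivity)]
  nlinarith [sq_nonneg ‖ω‖, sq_nonneg ‖(linMap Wᵀ).toContinuousLinearMap‖]

theorem sobolevNorm_comp_rangeRestrict_le {s : ℝ} (hs : (k : ℝ) / 2 < s)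
    {W : Matrix (Fin k') (Fin k) ℝ} (hW : 0 < (Wᵀ * W).det)
    (h : LinearMap.range (linMap W) → Vec m) :
    sobolevNorm s (fun x => h ((linMap W).rangeRestrict x)) ≤ weightFactor s W * sobolevNorm s h := by
  by_cases hh : sobolevNorm s h < ∞
  · obtain ⟨S, hS, hmap⟩ := exists_transposeEquiv hW
    have hJ : 0 < Real.sqrt (Wᵀ * W).det := Real.sqrt_pos.2 hW
    have hTS : ∀ x (ξ : LinearMap.range (linMap W)),
        (inner ℝ ξ ((linMap W).rangeRestrict x) : ℝ) = inner ℝ (S ξ) x := by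
      intro x ξ
      rw [hS, ← inner_linMap_right]
      rfl
    have := sobolevNorm_comp_linear_le (by rwa [finrank_range_linMap hW]) hh hJ hTS hmap
    refine this.trans (le_of_eq ?_)
    unfold weightFactor
    rw [iSup_subtype']
    -- J = det(WᵀW)^{1/2} enters as J^{-1/2}, whence the exponent 1/4.
    have h4 : Real.sqrt (Wᵀ * W).det ^ (1 / 2 : ℝ) = (Wᵀ * W).det ^ (1 / 4 : ℝ) := by
      rw [Real.sqrt_eq_rpow, ← Real.rpow_mul hW.le]
      norm_num
    rw [h4]
    simp only [hS]
    rfl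
  · rw [not_lt, top_le_iff] at hh
    rw [hh, ENNReal.mul_top (weightFactor_ne_zero s hW)]
    exact le_top

end Weights

/-! ### Passage to the quotient norm defined by M^{1/2}. -/

section VectorValued

variable {E : Type*} [NormedAddCommGroup E] [InnerProductSpace ℝ E] [FiniteDimensional ℝ E]
  [MeasurableSpace E] [BorelSpace E] {m : ℕ} {M : Matrix (Fin m) (Fin m) ℝ}

theorem exists_sobolevNorm_lt_of_vvNorm_lt {s : ℝ} {f : E → Vec m} {b : ℝ≥0∞}
    (h : vvNorm M s f < b) :
    ∃ h : E → Vec m, (∀ x, f x = Matrix.toEuclideanLin (CFC.sqrt M) (h x)) ∧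
      sobolevNorm s h < b := by
  obtain ⟨h, hh⟩ := iInf_lt_iff.1 h
  obtain ⟨hr, hb⟩ := iInf_lt_iff.1 hh
  exact ⟨h, hr, hb⟩

theorem vvNorm_le_sobolevNorm {s : ℝ} {f h : E → Vec m}
    (hr : ∀ x, f x = Matrix.toEuclideanLin (CFC.sqrt M) (h x)) :
    vvNorm M s f ≤ sobolevNorm s h :=
  iInf₂_le h hr

/-- M^{1/2} acts on values and commutes with precomposition, so every h with f = M^{1/2}h is carried
along and the scalar bound passes to the infimum. -/
theorem vvNorm_comp_add_le {s : ℝ} (hs : (Module.finrank ℝ E : ℝ) / 2 < s) (f : E → Vec m)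
    (a : E) : vvNorm M s (fun x => f (x + a)) ≤ vvNorm M s f :=
  le_iInf₂ fun h hr =>
    (vvNorm_le_sobolevNorm (h := fun x => h (x + a)) fun x => hr (x + a)).trans
      (sobolevNorm_comp_add hs h a)

theorem vvNorm_comp_linMap_le {k k' : ℕ} {s : ℝ} (hs : (k : ℝ) / 2 < s)
    {W : Matrix (Fin k') (Fin k) ℝ} (hW : 0 < (Wᵀ * W).det) (f : Vec k' → Vec m) :
    vvNorm M s (f ∘ linMap W) ≤
      weightFactor s W * vvNorm M s (fun y : LinearMap.range (linMap W) => f y) := by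
  have hs0 : 0 ≤ s := le_trans (by positivity) hs.le
  refine ENNReal.le_mul_of_forall_lt (Or.inl (weightFactor_ne_zero s hW))
    (Or.inl (weightFactor_ne_top hs0 W)) fun a ha b hb => ?_
  obtain ⟨h, hr, hlt⟩ := exists_sobolevNorm_lt_of_vvNorm_lt hb
  have hr' : ∀ x, (f ∘ linMap W) x =
      Matrix.toEuclideanLin (CFC.sqrt M) (h ((linMap W).rangeRestrict x)) := fun x =>
    hr ((linMap W).rangeRestrict x)
  calc _ ≤ _ := vvNorm_le_sobolevNorm hr'
    _ ≤ _ := sobolevNorm_comp_rangeRestrict_le hs hW h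
    _ ≤ _ := mul_le_mul' (le_of_lt ha) hlt.le

theorem vvNorm_zero (s : ℝ) : vvNorm M s (fun _ : E => (0 : Vec m)) = 0 := by
  have H : HasSpectrum (fun _ : E => (0 : Vec m)) 0 := by
    refine ⟨integrable_zero _ _ _, MemLp.zero, fun x => ?_⟩
    rw [Real.fourierInv_eq', ← complexifyCLM_apply, map_zero]
    simp
  refine le_antisymm ((vvNorm_le_sobolevNorm (h := fun _ => 0) fun x => ?_).trans ?_) bot_le
  · rw [map_zero]
  · rw [H.sobolevNorm_eq]
    simp [weightedSpectralNorm]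

theorem vvNorm_comp_le_koopmanNorm {s : ℝ} {φ : E → E} {f : E → Vec m}
    (hφ : koopmanNorm M s φ < ∞) (hf : vvNorm M s f < ∞) :
    vvNorm M s (f ∘ φ) ≤ koopmanNorm M s φ * vvNorm M s f := by
  refine ENNReal.le_mul_of_forall_lt (Or.inr hf.ne) (Or.inl hφ.ne) fun a ha b hb => ?_
  obtain ⟨c, hc, hca⟩ := sInf_lt_iff.1 ha
  exact (hc f hf).trans (mul_le_mul' hca.le (le_of_lt hb))

theorem transpose_sqrt (M : Matrix (Fin m) (Fin m) ℝ) : (CFC.sqrt M)ᵀ = CFC.sqrt M := by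
  have := (Matrix.nonneg_iff_posSemidef.1 (CFC.sqrt_nonneg M)).isHermitian.eq
  rwa [Matrix.conjTranspose_eq_transpose_of_trivial] at this

theorem inner_sqrt_sqrt (hM : M.PosSemidef) (v w : Vec m) :
    (inner ℝ (linMap (CFC.sqrt M) v) (linMap (CFC.sqrt M) w) : ℝ) =
      ∑ b, ∑ b', v b * w b' * M b b' := by
  rw [inner_linMap_right, transpose_sqrt, ← linMap_mul_apply,
    CFC.sqrt_mul_sqrt_self M (Matrix.nonneg_iff_posSemidef.2 hM)]
  have hMt : Mᵀ = M := by
    have := hM.isHermitian.eq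
    rwa [Matrix.conjTranspose_eq_transpose_of_trivial] at this
  conv_lhs => rw [← hMt]
  rw [← inner_linMap_right]
  simp only [PiLp.inner_apply, Matrix.toLpLin_apply, Matrix.mulVec, dotProduct,
    RCLike.inner_apply, conj_trivial, Finset.sum_mul]
  refine Finset.sum_congr rfl fun b _ => Finset.sum_congr rfl fun b' _ => ?_
  ring

/-- The reproducing inequality of the vector-valued space. -/
theorem sum_inner_le_vvNorm {s : ℝ} (hs : (Module.finrank ℝ E : ℝ) / 2 < s)
    {f : E → Vec m} (hf : vvNorm M s f < ∞) {n : ℕ} (x : Fin n → E) (c : Fin n → Vec m) :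
    ENNReal.ofReal |∑ i, inner ℝ (c i) (f (x i))| ≤
      ENNReal.ofReal (Real.sqrt (∑ i, ∑ j, sobolevKernel s (x i) (x j) *
        inner ℝ (linMap (CFC.sqrt M) (c i)) (linMap (CFC.sqrt M) (c j)))) * vvNorm M s f := by
  refine ENNReal.le_mul_of_forall_lt (Or.inr hf.ne) (Or.inl ENNReal.ofReal_ne_top)
    fun a ha b hb => ?_
  -- `b` may be ∞; the minimum with ∞ from `hf` ensures that the chosen h itself has finite norm.
  obtain ⟨h, hr, hlt⟩ := exists_sobolevNorm_lt_of_vvNorm_lt (lt_min hb hf)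
  have heq : ∀ i, (inner ℝ (c i) (f (x i)) : ℝ) =
      inner ℝ (linMap (CFC.sqrt M) (c i)) (h (x i)) := by
    intro i
    rw [hr, inner_linMap_right, transpose_sqrt]
  simp only [heq]
  exact (sum_inner_le_sobolevNorm hs h (hlt.trans_le (min_le_right _ _)) x _).trans
    (mul_le_mul' (le_of_lt ha) (hlt.le.trans (min_le_left _ _)))

/-- The reproducing inequality at the single point x with coefficient f x gives ‖f x‖² ≤ 0. This
justifies the convention 0/0 = 0 in `normRatio`. -/
theorem eq_zero_of_vvNorm_eq_zero {s : ℝ} (hs : (Module.finrank ℝ E : ℝ) / 2 < s)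
    {f : E → Vec m} (hf : vvNorm M s f = 0) (x : E) : f x = 0 := by
  have h := sum_inner_le_vvNorm (M := M) hs (f := f) (by rw [hf]; exact ENNReal.zero_lt_top)
    (fun _ : Fin 1 => x) (fun _ => f x)
  rw [hf, mul_zero] at h
  simpa using h

theorem vvNorm_range_le_normRatio_mul {k k' : ℕ} {s s' : ℝ} (hs' : (k' : ℝ) / 2 < s')
    (W : Matrix (Fin k') (Fin k) ℝ) {f : Vec k' → Vec m} (hf : vvNorm M s' f < ∞) :
    vvNorm M s (fun y : LinearMap.range (linMap W) => f y) ≤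
      normRatio M s s' W f * vvNorm M s' f := by
  by_cases h0 : vvNorm M s' f = 0
  · have hf0 : ∀ y, f y = 0 := eq_zero_of_vvNorm_eq_zero (by simpa using hs') h0
    simp only [hf0, vvNorm_zero]
    exact bot_le
  · rw [normRatio, ENNReal.div_mul_cancel h0 hf.ne]

end VectorValued

/-! ### Averaging over signs. -/

section Rademacher

variable {n m : ℕ}

/-- The vectors `(ε i j)_j` of a sign pattern. -/
def signVec (ε : Fin n → Fin m → ℤˣ) (i : Fin n) : Vec m :=
  WithLp.toLp 2 fun j => ((ε i j : ℤ) : ℝ)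

theorem sum_sign_mul_sign (p q : Fin n × Fin m) :
    ∑ ε : Fin n → Fin m → ℤˣ, ((ε p.1 p.2 : ℤ) : ℝ) * ((ε q.1 q.2 : ℤ) : ℝ) =
      if p = q then (Fintype.card (Fin n → Fin m → ℤˣ) : ℝ) else 0 := by
  split_ifs with h
  · subst h
    have : ∀ u : ℤˣ, ((u : ℤ) : ℝ) * ((u : ℤ) : ℝ) = 1 := by
      intro u
      rcases Int.units_eq_one_or u with rfl | rfl <;> simp
    simp [this]
  -- Flipping the sign at the single position p permutes the patterns and negates each summand.
  · set δ : Fin n → Fin m → ℤˣ := fun i j => if (i, j) = p then -1 else 1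
    have hp : δ p.1 p.2 = -1 := by simp [δ]
    have hq : δ q.1 q.2 = 1 := by simp [δ, Ne.symm h]
    have hflip := Equiv.sum_comp (Equiv.mulLeft δ)
      (fun ε : Fin n → Fin m → ℤˣ => ((ε p.1 p.2 : ℤ) : ℝ) * ((ε q.1 q.2 : ℤ) : ℝ))
    simp only [Equiv.coe_mulLeft, Pi.mul_apply, hp, hq, one_mul, neg_mul, Units.val_neg,
      Int.cast_neg, Finset.sum_neg_distrib] at hflip
    linarith

theorem sum_inner_sqrt_signVec {M : Matrix (Fin m) (Fin m) ℝ} (hM : M.PosSemidef)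
    (i j : Fin n) :
    ∑ ε : Fin n → Fin m → ℤˣ, (inner ℝ (linMap (CFC.sqrt M) (signVec ε i))
        (linMap (CFC.sqrt M) (signVec ε j)) : ℝ) =
      if i = j then (Fintype.card (Fin n → Fin m → ℤˣ) : ℝ) * M.trace else 0 := by
  simp only [inner_sqrt_sqrt hM, signVec]
  rw [Finset.sum_comm]
  simp_rw [Finset.sum_comm (s := (Finset.univ : Finset (Fin n → Fin m → ℤˣ))), ← Finset.sum_mul]
  have h := fun b b' : Fin m => sum_sign_mul_sign (i, b) (j, b')
  simp only [Prod.mk.injEq] at h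
  simp only [h]
  split_ifs with hij
  · simp [hij, Matrix.trace, Finset.mul_sum]
  · simp [hij]

theorem average_sqrt_le_sqrt {ι : Type*} [Fintype ι] [Nonempty ι] {Q : ι → ℝ}
    (hQ : ∀ e, 0 ≤ Q e) :
    (Fintype.card ι : ℝ)⁻¹ * ∑ e, Real.sqrt (Q e) ≤
      Real.sqrt ((Fintype.card ι : ℝ)⁻¹ * ∑ e, Q e) := by
  have hN : (0 : ℝ) < Fintype.card ι := by exact_mod_cast Fintype.card_pos
  refine Real.le_sqrt_of_sq_le ?_
  have h := sq_sum_le_card_mul_sum_sq (s := Finset.univ) (f := fun e => Real.sqrt (Q e))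
  simp only [Real.sq_sqrt (hQ _), Finset.card_univ] at h
  rw [mul_pow]
  calc _ ≤ (Fintype.card ι : ℝ)⁻¹ ^ 2 * (Fintype.card ι * ∑ e, Q e) := by gcongr
    _ = _ := by field_simp

/-- Rademacher complexity of a class of functions of bounded norm. -/
theorem empiricalRademacher_le_of_vvNorm_le {E : Type*} [NormedAddCommGroup E]
    [InnerProductSpace ℝ E] [FiniteDimensional ℝ E] [MeasurableSpace E] [BorelSpace E]
    {s : ℝ} (hs : (Module.finrank ℝ E : ℝ) / 2 < s) {M : Matrix (Fin m) (Fin m) ℝ}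
    (hM : M.PosSemidef) (x : Fin n → E) {κ : ℝ} (hκ : ∀ i, sobolevKernel s (x i) (x i) ≤ κ)
    {H : Set (E → Vec m)} {B : ℝ≥0∞} (hH : ∀ f ∈ H, vvNorm M s f < ∞ ∧ vvNorm M s f ≤ B) :
    empiricalRademacher H x ≤ B * ENNReal.ofReal (Real.sqrt (κ / n * M.trace)) := by
  set N : ℝ := (Fintype.card (Fin n → Fin m → ℤˣ) : ℝ) with hNdef
  have hN : 0 < N := Nat.cast_pos.2 Fintype.card_pos
  have hn : (0 : ℝ) ≤ 1 / n := by positivity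
  set Q : (Fin n → Fin m → ℤˣ) → ℝ := fun ε => ∑ i, ∑ j, sobolevKernel s (x i) (x j) *
    inner ℝ (linMap (CFC.sqrt M) (signVec ε i)) (linMap (CFC.sqrt M) (signVec ε j)) with hQdef
  have hQ : ∀ ε, 0 ≤ Q ε := fun ε => sum_sobolevKernel_nonneg hs x _
  have hsup : ∀ ε : Fin n → Fin m → ℤˣ, (⨆ f ∈ H,
      ENNReal.ofReal (1 / n * |∑ i, ∑ j, ((ε i j : ℤ) : ℝ) * f (x i) j|)) ≤
        B * ENNReal.ofReal (1 / n * Real.sqrt (Q ε)) := by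
    intro ε
    refine iSup₂_le fun f hf => ?_
    have h := sum_inner_le_vvNorm hs (hH f hf).1 x (signVec ε)
    have heq : ∀ i, (inner ℝ (signVec ε i) (f (x i)) : ℝ) = ∑ j, ((ε i j : ℤ) : ℝ) * f (x i) j := by
      intro i
      simp [PiLp.inner_apply, signVec, mul_comm]
    simp only [heq] at h
    rw [ENNReal.ofReal_mul hn, ENNReal.ofReal_mul hn]
    calc _ ≤ ENNReal.ofReal (1 / n) * (ENNReal.ofReal (Real.sqrt (Q ε)) * vvNorm M s f) := by
          gcongr
      _ ≤ ENNReal.ofReal (1 / n) * (ENNReal.ofReal (Real.sqrt (Q ε)) * B) := by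
          gcongr
          exact (hH f hf).2
      _ = _ := by ring
  -- Independence of the signs leaves only the diagonal i = j, each term contributing Tr M.
  have hQsum : ∑ ε, Q ε = N * ((∑ i, sobolevKernel s (x i) (x i)) * M.trace) := by
    simp only [hQdef]
    rw [Finset.sum_comm]
    simp_rw [Finset.sum_comm (s := (Finset.univ : Finset (Fin n → Fin m → ℤˣ))),
      ← Finset.mul_sum, sum_inner_sqrt_signVec hM]
    simp only [mul_ite, mul_zero, Finset.sum_ite_eq, Finset.mem_univ, if_true]
    rw [Finset.sum_mul, Finset.mul_sum]
    refine Finset.sum_congr rfl fun i _ => ?_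
    ring
  have hreal : N⁻¹ * ∑ ε, (1 / n * Real.sqrt (Q ε)) ≤ Real.sqrt (κ / n * M.trace) := by
    rw [← Finset.mul_sum, mul_left_comm]
    refine (mul_le_mul_of_nonneg_left (average_sqrt_le_sqrt hQ) hn).trans ?_
    rw [← hNdef, hQsum, inv_mul_cancel_left₀ hN.ne']
    rcases Nat.eq_zero_or_pos n with rfl | hn0
    · simp
    have hn0' : (0 : ℝ) < n := by exact_mod_cast hn0
    refine Real.le_sqrt_of_sq_le ?_
    have hk : ∑ i, sobolevKernel s (x i) (x i) ≤ n * κ := by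
      refine (Finset.sum_le_sum fun i _ => hκ i).trans ?_
      simp
    have hpos : 0 ≤ (∑ i, sobolevKernel s (x i) (x i)) * M.trace := by
      have : 0 ≤ N * ((∑ i, sobolevKernel s (x i) (x i)) * M.trace) := by
        rw [← hQsum]
        exact Finset.sum_nonneg fun ε _ => hQ ε
      exact nonneg_of_mul_nonneg_right this hN
    rw [mul_pow, Real.sq_sqrt hpos]
    calc _ ≤ (1 / (n : ℝ)) ^ 2 * (n * κ * M.trace) := by
          gcongr
          exact hM.trace_nonneg
      _ = _ := by field_simp
  have hcard : ((Fintype.card (Fin n → Fin m → ℤˣ) : ℝ≥0∞))⁻¹ = ENNReal.ofReal N⁻¹ := by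
    rw [ENNReal.ofReal_inv_of_pos hN, hNdef, ENNReal.ofReal_natCast]
  unfold empiricalRademacher
  rw [hcard]
  calc _ ≤ ENNReal.ofReal N⁻¹ * ∑ ε, B * ENNReal.ofReal (1 / n * Real.sqrt (Q ε)) := by
        gcongr with ε
        exact hsup ε
    _ = B * ENNReal.ofReal (N⁻¹ * ∑ ε, (1 / n * Real.sqrt (Q ε))) := by
        rw [← Finset.mul_sum, ENNReal.ofReal_mul (by positivity),
          ENNReal.ofReal_sum_of_nonneg fun ε _ => by positivity]
        ring
    _ ≤ _ := by gcongr

end Rademacher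

/-! ### Induction over the layers. -/

section Layers

variable {m L : ℕ} {d : ℕ → ℕ}

theorem tailNet_last (g : Vec (d L) → Vec m) (σ : ∀ l, Vec (d l) → Vec (d l))
    (W : ∀ l, Matrix (Fin (d (l + 1))) (Fin (d l)) ℝ) (a : ∀ l, Vec (d l)) :
    tailNet g σ W a (le_refl L) = fun x => g (x + a L) := by
  funext x
  rw [tailNet, afterShift, Nat.decreasingInduction_self]

theorem tailNet_of_lt (g : Vec (d L) → Vec m) (σ : ∀ l, Vec (d l) → Vec (d l))
    (W : ∀ l, Matrix (Fin (d (l + 1))) (Fin (d l)) ℝ) (a : ∀ l, Vec (d l))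
    {l : ℕ} (hl : l < L) :
    tailNet g σ W a hl.le = fun x =>
      ((tailNet g σ W a (Nat.succ_le_of_lt hl) ∘ linMap (W l)) ∘ σ l) (x + a l) := by
  funext x
  rw [tailNet, afterShift, Nat.decreasingInduction_succ_left _ _ (Nat.succ_le_of_lt hl)]
  rfl

/-- The factor that the weight matrix of layer `l + 1` contributes to the bound. -/
def layerFactor (M : Matrix (Fin m) (Fin m) ℝ) (s : ℕ → ℝ) (g : Vec (d L) → Vec m)
    (σ : ∀ l, Vec (d l) → Vec (d l)) (W : ∀ l, Matrix (Fin (d (l + 1))) (Fin (d l)) ℝ)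
    (a : ∀ l, Vec (d l)) (l : ℕ) : ℝ≥0∞ :=
  -- The condition supplies the bound that `tailNet` requires; the value 1 never enters a product
  -- over indices below `L`.
  if hl : l < L then
    normRatio M (s l) (s (l + 1)) (W l) (tailNet g σ W a (Nat.succ_le_of_lt hl)) *
      weightFactor (s l) (W l)
  else 1

variable {s : ℕ → ℝ} {M : Matrix (Fin m) (Fin m) ℝ} {g : Vec (d L) → Vec m}
  {σ : ∀ l, Vec (d l) → Vec (d l)} {W : ∀ l, Matrix (Fin (d (l + 1))) (Fin (d l)) ℝ}
  {a : ∀ l, Vec (d l)}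

theorem vvNorm_tailNet_comp_linMap_le (hs : ∀ l ≤ L, (d l : ℝ) / 2 < s l)
    (hdet : ∀ l < L, 0 < ((W l)ᵀ * W l).det) {l : ℕ} (hl : l < L)
    (hfin : vvNorm M (s (l + 1)) (tailNet g σ W a (Nat.succ_le_of_lt hl)) < ∞) :
    vvNorm M (s l) (tailNet g σ W a (Nat.succ_le_of_lt hl) ∘ linMap (W l)) ≤
      layerFactor M s g σ W a l *
        vvNorm M (s (l + 1)) (tailNet g σ W a (Nat.succ_le_of_lt hl)) := by
  rw [layerFactor, dif_pos hl, mul_right_comm, mul_comm]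
  exact (vvNorm_comp_linMap_le (hs l hl.le) (hdet l hl) _).trans
    (mul_le_mul_right (vvNorm_range_le_normRatio_mul (hs (l + 1) hl) (W l) hfin) _)

/-- Downward induction from the last layer. Finiteness is carried along, since the Koopman norm and
G_l control only functions of finite norm; it comes from `hW`, as the ratios in the bound are not
known to be finite. -/
theorem vvNorm_tailNet_le (hs : ∀ l ≤ L, (d l : ℝ) / 2 < s l)
    (hg : vvNorm M (s L) g < ∞)
    (hσ : ∀ l, 1 ≤ l → l < L → koopmanNorm M (s l) (σ l) < ∞)
    (hdet : ∀ l < L, 0 < ((W l)ᵀ * W l).det)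
    (hW : ∀ l < L, ∀ h : Vec (d (l + 1)) → Vec m,
      vvNorm M (s (l + 1)) h < ∞ → vvNorm M (s l) (h ∘ linMap (W l)) < ∞)
    {l : ℕ} (hl : l ≤ L) (h1 : 1 ≤ l) :
    vvNorm M (s l) (tailNet g σ W a hl) < ∞ ∧
      vvNorm M (s l) (tailNet g σ W a hl) ≤ vvNorm M (s L) g *
        ∏ k ∈ Finset.Ico l L, (layerFactor M s g σ W a k * koopmanNorm M (s k) (σ k)) := by
  have hs' : ∀ l ≤ L, (Module.finrank ℝ (Vec (d l)) : ℝ) / 2 < s l := fun l hl => by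
    rw [finrank_euclideanSpace_fin]; exact hs l hl
  revert h1
  induction hl using Nat.decreasingInduction with
  | self =>
    intro _
    rw [tailNet_last]
    have h := vvNorm_comp_add_le (M := M) (hs' L le_rfl) g (a L)
    exact ⟨h.trans_lt hg, by simpa using h⟩
  | of_succ l hl ih =>
    intro h1
    obtain ⟨ihfin, ihle⟩ := ih (by omega)
    have hWfin := hW l hl _ ihfin
    have hk := hσ l h1 hl
    have hstep : vvNorm M (s l) (tailNet g σ W a hl.le) ≤ koopmanNorm M (s l) (σ l) *
        vvNorm M (s l) (tailNet g σ W a (Nat.succ_le_of_lt hl) ∘ linMap (W l)) := by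
      rw [tailNet_of_lt g σ W a hl]
      exact (vvNorm_comp_add_le (hs' l hl.le) _ (a l)).trans
        (vvNorm_comp_le_koopmanNorm hk hWfin)
    refine ⟨hstep.trans_lt (ENNReal.mul_lt_top hk hWfin), hstep.trans ?_⟩
    rw [Finset.prod_eq_prod_Ico_succ_bot hl]
    calc _ ≤ koopmanNorm M (s l) (σ l) * (layerFactor M s g σ W a l *
          (vvNorm M (s L) g * ∏ k ∈ Finset.Ico (l + 1) L,
            (layerFactor M s g σ W a k * koopmanNorm M (s k) (σ k)))) := by
          gcongr
          exact (vvNorm_tailNet_comp_linMap_le hs hdet hl ihfin).trans (by gcongr)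
      _ = _ := by ring

/-- The first weight matrix has no activation before it, so its factor is split off: weights run
over 0, …, L-1 and activations over 1, …, L-1. -/
theorem vvNorm_network_le (hL : 1 ≤ L) (hs : ∀ l ≤ L, (d l : ℝ) / 2 < s l)
    (hg : vvNorm M (s L) g < ∞)
    (hσ : ∀ l, 1 ≤ l → l < L → koopmanNorm M (s l) (σ l) < ∞)
    (hdet : ∀ l < L, 0 < ((W l)ᵀ * W l).det)
    (hW : ∀ l < L, ∀ h : Vec (d (l + 1)) → Vec m,
      vvNorm M (s (l + 1)) h < ∞ → vvNorm M (s l) (h ∘ linMap (W l)) < ∞) :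
    vvNorm M (s 0) (network hL g σ W a) < ∞ ∧
      vvNorm M (s 0) (network hL g σ W a) ≤ vvNorm M (s L) g *
        (∏ l : Fin L, (normRatio M (s l) (s (l + 1)) (W l)
          (tailNet g σ W a (Nat.succ_le_of_lt l.isLt)) * weightFactor (s l) (W l))) *
        ∏ l ∈ Finset.Ico 1 L, koopmanNorm M (s l) (σ l) := by
  obtain ⟨hfin, hle⟩ := vvNorm_tailNet_le (a := a) hs hg hσ hdet hW hL le_rfl
  have hprod : (∏ l : Fin L, (normRatio M (s l) (s (l + 1)) (W l)
      (tailNet g σ W a (Nat.succ_le_of_lt l.isLt)) * weightFactor (s l) (W l))) =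
      layerFactor M s g σ W a 0 * ∏ l ∈ Finset.Ico 1 L, layerFactor M s g σ W a l := by
    rw [← Finset.prod_eq_prod_Ico_succ_bot (a := 0) hL, ← Finset.range_eq_Ico,
      Finset.prod_range]
    refine Finset.prod_congr rfl fun l _ => ?_
    rw [layerFactor, dif_pos l.isLt]
  refine ⟨hW 0 hL _ hfin, ?_⟩
  rw [hprod]
  calc _ ≤ layerFactor M s g σ W a 0 * (vvNorm M (s L) g * ∏ k ∈ Finset.Ico 1 L,
        (layerFactor M s g σ W a k * koopmanNorm M (s k) (σ k))) :=
        (vvNorm_tailNet_comp_linMap_le hs hdet hL hfin).trans (mul_le_mul_right hle _)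
    _ = _ := by
        rw [Finset.prod_mul_distrib]
        ring

end Layers

end

theorem mainTheorem2
    {m n L : ℕ} (hL : 1 ≤ L)
    -- widths `d 0, …, d L` and smoothness orders `s 0, …, s L`
    (d : ℕ → ℕ) (s : ℕ → ℝ) (hs : ∀ l ≤ L, (d l : ℝ) / 2 < s l)
    -- output matrix of the decomposable kernels `k_{s_l} M`
    (M : Matrix (Fin m) (Fin m) ℝ) (hM : M.PosSemidef)
    -- input space, sample, and the bound on the kernel
    (X : Set (Vec (d 0))) (x : Fin n → Vec (d 0)) (hx : ∀ i, x i ∈ X)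
    (κ : ℝ) (hκ : ∀ y ∈ X, ∀ y' ∈ X, sobolevKernel (s 0) y y' ≤ κ)
    -- final transformation and activation functions
    (g : Vec (d L) → Vec m) (hg : vvNorm M (s L) g < ∞)
    (σ : ∀ l, Vec (d l) → Vec (d l))
    (hσ : ∀ l, 1 ≤ l → l < L → koopmanNorm M (s l) (σ l) < ∞)
    -- bounds on the weights and sets of allowed biases
    (C D : ℝ) (hC : 0 < C) (hD : 0 < D) (A : ∀ l, Set (Vec (d l)))
    -- the weights have Koopman operators `H^{s_{l+1}} → H^{s_l}`
    (hW : ∀ l < L, ∀ W ∈ weightSet C D (d l) (d (l + 1)), ∀ h : Vec (d (l + 1)) → Vec m,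
      vvNorm M (s (l + 1)) h < ∞ → vvNorm M (s l) (h ∘ linMap W) < ∞) :
    empiricalRademacher (injClass hL g σ C D A) x ≤
      vvNorm M (s L) g * ENNReal.ofReal (Real.sqrt (κ / n * M.trace)) *
        (⨆ p ∈ admissible L d C D A, ∏ l : Fin L,
          (normRatio M (s l) (s (l + 1)) (p.1 l)
              (tailNet g σ p.1 p.2 (Nat.succ_le_of_lt l.isLt)) *
            weightFactor (s l) (p.1 l))) *
        ∏ l ∈ Finset.Ico 1 L, koopmanNorm M (s l) (σ l) := by
  -- The whole class lies in one norm ball whose radius is the right-hand side without the sampling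
  -- factor.
  have hbound : ∀ f ∈ injClass hL g σ C D A, vvNorm M (s 0) f < ∞ ∧ vvNorm M (s 0) f ≤
      vvNorm M (s L) g * (⨆ p ∈ admissible L d C D A, ∏ l : Fin L,
          (normRatio M (s l) (s (l + 1)) (p.1 l)
              (tailNet g σ p.1 p.2 (Nat.succ_le_of_lt l.isLt)) *
            weightFactor (s l) (p.1 l))) *
        ∏ l ∈ Finset.Ico 1 L, koopmanNorm M (s l) (σ l) := by
    rintro f ⟨p, hp, rfl⟩
    obtain ⟨hfin, hle⟩ := vvNorm_network_le (a := p.2) hL hs hg hσ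
      (fun l hl => det_pos_of_mem_weightSet hD (hp l hl).1)
      (fun l hl => hW l hl (p.1 l) (hp l hl).1)
    refine ⟨hfin, hle.trans ?_⟩
    gcongr
    exact le_iSup₂ (f := fun (p : (∀ l, Matrix (Fin (d (l + 1))) (Fin (d l)) ℝ) ×
        (∀ l, Vec (d l))) (_ : p ∈ admissible L d C D A) => ∏ l : Fin L,
          (normRatio M (s l) (s (l + 1)) (p.1 l)
              (tailNet g σ p.1 p.2 (Nat.succ_le_of_lt l.isLt)) *
            weightFactor (s l) (p.1 l))) p hp
  refine (empiricalRademacher_le_of_vvNorm_le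
    (by rw [finrank_euclideanSpace_fin]; exact hs 0 (Nat.zero_le L)) hM x
    (fun i => hκ _ (hx i) _ (hx i)) hbound).trans (le_of_eq ?_)
  ring
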